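/- Work in the language of second order arithmetic, with $\mathsf{RCA}_0$ as usual (basic axioms, $\Sigma^0_1$ induction, $\Delta^0_1$ comprehension, with parameters), $(i,j)=(i+j)^2+i$, and functions between sets of numbers represented by sets of pairs. Let $\mathrm{Seq}$ be the set of codes of finite sequences of numbers; for $l\in\mathrm{Seq}$ let $A_l=\{l(i): i<\mathrm{lh}\,l\}$. Write $[i]=\{j: j\le i\}$, and $\bar f y$ for the code of $\langle f(0),\dots,f(y-1)\rangle$. For a set $A$, $|A|=m$ means that there is a bijection from $\{i: i<m\}$ onto $A$, and $|A|>m$ means that $|A|=m'$ for some $m'>m$. A set is finite if it is bounded. A function $F:\mathbb N\to\mathbb N$ is *extensional* if $F(l)=F(l')$ for all $l,l'\in\mathrm{Seq}$ with $A_l=A_{l'}$. A sequence $(l_m)$ with all $l_m\in\mathrm{Seq}$ is a *nested sequence with union* if $A_{l_m}\subseteq A_{l_{m+1}}$ for all $m$ and the set $\bigcup_m A_{l_m}$ exists; it *weakly converges* if there is an infinite set $A$ such that for every finite set $B$ there is an $i$ with $A_{l_j}\cap B=A\cap B$ for all $j\ge i$. We write $F\in AS$ ($F$ is *asymptotically stable*)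 if $F$ is extensional and for every nested sequence with union $(l_m)$ there is an $i$ with $F(l_i)=F(l_j)$ for all $j\ge i$; we write $F\in ASNIS$ ($F$ is *asymptotically stable near infinite sets*) if $F$ is extensional and for every weakly convergent $(l_m)$ there is an $i$ with $F(l_i)=F(l_j)$ for all $j\ge i$. Consider the following sentences. - $\mathsf{IPP}$: $\forall n\ \forall f:\mathbb N\to[n]\ \exists c\in[n]\ \big(f^{-1}(c)\text{ is infinite}\big)$. - $\mathsf{FIPP}_2$: $\forall n\ \forall F\in AS\ \exists k\ \forall f:[k]\to[n]\ \exists l\in\mathrm{Seq}\ \big(A_l\subseteq[k]\wedge|A_l|>F(l)\wedge f|_{A_l}\text{ is constant}\big)$. - $\mathsf{FIPP}_3$: $\forall n\ \forall F\in ASNIS\ \exists k\ \forall f:[k]\to[n]\ \exists l\in\mathrm{Seq}\ \exists c\in[n]\ \big(A_l=f^{-1}(c)\wedge|A_l|>F(l)\big)$. For a class $\Gamma$ of formulas, $\Gamma\text{-}\mathsf{CUB}$ (continuous uniform boundedness) is the schema $$\forall n\ \Big[\big(\mathrm{cont}(A)\wedge\forall f:\mathbb N\to[n]\ \exists\underline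 x\ A(f,\underline x)\big)\to\exists z\ \forall f:\mathbb N\to[n]\ \exists\underline x\le z\ A(f,\underline x)\Big],$$ where $A(f,\underline x)$ ranges over the formulas in $\Gamma$ with a distinguished set variable $f$ and a distinguished tuple $\underline x$ of number variables, possibly with further parameters but with $n$ not free in $A$, and where $\mathrm{cont}(A)$ is $$\forall f:\mathbb N\to[n]\ \forall z\ \exists y\ \forall g:\mathbb N\to[n]\ \big[\bar f y=\bar g y\to\forall\underline x\le z\ \big(A(f,\underline x)\leftrightarrow A(g,\underline x)\big)\big].$$ **Theorem.** 1. $\mathsf{RCA}_0+\Sigma^0_0\text{-}\mathsf{CUB}$ proves $\mathsf{IPP}\to\mathsf{FIPP}_2$. 2. $\mathsf{RCA}_0+\Pi^0_1\text{-}\mathsf{CUB}$ proves $\mathsf{IPP}\to\mathsf{FIPP}_3$. -/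

import Mathlib

namespace SOA

/-! ## The language of second order arithmetic

Two sorts: numbers and sets of numbers. Variables of both sorts are de Bruijn indices, counted
separately for the two sorts. -/

/-- Numerical terms: number variables, `0`, `1`, sums and products. -/
inductive Tm : Type
  | var (i : ℕ) : Tm
  | zero : Tm
  | one : Tm
  | add (s t : Tm) : Tm
  | mul (s t : Tm) : Tm

/-- The number variable with index `i`. -/
abbrev v (i : ℕ) : Tm := Tm.var i

instance : Zero Tm := ⟨Tm.zero⟩
instance : One Tm := ⟨Tm.one⟩
instance : Add Tm := ⟨Tm.add⟩
instance : Mul Tm := ⟨Tm.mul⟩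

namespace Tm

/-- Simultaneous substitution of terms for the number variables of a term. -/
def subst (σ : ℕ → Tm) : Tm → Tm
  | var i => σ i
  | zero => zero
  | one => one
  | add s t => add (s.subst σ) (t.subst σ)
  | mul s t => mul (s.subst σ) (t.subst σ)

/-- The term `t` moved under `k` further number quantifiers. -/
def lift (k : ℕ) (t : Tm) : Tm := t.subst (fun i => v (i + k))

end Tm

/-- Formulas of second order arithmetic: atomic formulas `s = t`, `s < t`, `t ∈ X`, closed under
falsum, implication, number quantification and set quantification. The other connectives and
quantifiers are the usual classical abbreviations. -/
inductive Fml : Type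
  | eq (s t : Tm) : Fml
  | lt (s t : Tm) : Fml
  | mem (t : Tm) (X : ℕ) : Fml
  | bot : Fml
  | imp (A B : Fml) : Fml
  | allN (A : Fml) : Fml
  | allS (A : Fml) : Fml

namespace Fml

def neg (A : Fml) : Fml := imp A bot
def top : Fml := neg bot
def conj (A B : Fml) : Fml := neg (imp A (neg B))
def disj (A B : Fml) : Fml := imp (neg A) B
def iff (A B : Fml) : Fml := conj (imp A B) (imp B A)
/-- `∃ x A`, for numbers. -/
def exN (A : Fml) : Fml := neg (allN (neg A))
/-- `∃ X A`, for sets. -/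
def exS (A : Fml) : Fml := neg (allS (neg A))

/-- Simultaneous capture-avoiding substitution of terms for number variables and of set variables
for set variables. -/
def subst : (σ : ℕ → Tm) → (ρ : ℕ → ℕ) → Fml → Fml
  | σ, _, eq s t => eq (s.subst σ) (t.subst σ)
  | σ, _, lt s t => lt (s.subst σ) (t.subst σ)
  | σ, ρ, mem t X => mem (t.subst σ) (ρ X)
  | _, _, bot => bot
  | σ, ρ, imp A B => imp (subst σ ρ A) (subst σ ρ B)
  | σ, ρ, allN A => allN (subst (fun | 0 => v 0 | i + 1 => (σ i).lift 1) ρ A)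
  | σ, ρ, allS A => allS (subst σ (fun | 0 => 0 | i + 1 => ρ i + 1) A)

/-- `A` moved under one further number quantifier. -/
def liftN (A : Fml) : Fml := A.subst (fun i => v (i + 1)) id

/-- `A` moved under one further set quantifier. -/
def liftS (A : Fml) : Fml := A.subst v (fun X => X + 1)

/-- `A(t)`, where number variable `0` is the distinguished variable of `A`; the quantifier which
binds it is removed. -/
def instN (A : Fml) (t : Tm) : Fml := A.subst (fun | 0 => t | i + 1 => v i) id

/-- `A(Y)`, where set variable `0` is the distinguished variable of `A`; the quantifier which
binds it is removed. -/
def instS (A : Fml) (Y : ℕ) : Fml := A.subst v (fun | 0 => Y | i + 1 => i)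

/-- `A(t)` placed under `k` further number quantifiers, where number variable `0` is the
distinguished variable of `A` (and `t` is a term in the extended context). -/
def app (A : Fml) (k : ℕ) (t : Tm) : Fml := A.subst (fun | 0 => t | i + 1 => v (i + k)) id

end Fml

infix:64 " =ₒ " => Fml.eq
infix:64 " <ₒ " => Fml.lt
infix:64 " ∈ₒ " => Fml.mem
prefix:max "¬ₒ" => Fml.neg
infixr:62 " ∧ₒ " => Fml.conj
infixr:61 " ∨ₒ " => Fml.disj
infixr:60 " →ₒ " => Fml.imp
infix:59 " ↔ₒ " => Fml.iff

open Fml (allN allS exN exS)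

/-- `s ≤ t`. -/
def le (s t : Tm) : Fml := s <ₒ t ∨ₒ s =ₒ t

/-- `∀ x < t, A`; the bound `t` does not contain the bound variable. -/
def ballN (t : Tm) (A : Fml) : Fml := allN (v 0 <ₒ t.lift 1 →ₒ A)

/-- `∃ x < t, A`; the bound `t` does not contain the bound variable. -/
def bexN (t : Tm) (A : Fml) : Fml := ¬ₒ(ballN t (¬ₒA))

/-! ## Provability -/

/-- Derivability from the axioms `T` under the assumptions `Γ`: classical natural deduction for
two-sorted logic with equality between numbers. Free variables in axioms (but not those in
assumptions) are read as universally quantified, that is, an axiom stands for its universal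
closure. -/
inductive Derives (T : Set Fml) : List Fml → Fml → Prop
  | ax {Γ : List Fml} {A : Fml} : A ∈ T → Derives T Γ A
  | hyp {Γ : List Fml} {A : Fml} : A ∈ Γ → Derives T Γ A
  | impI {Γ : List Fml} {A B : Fml} : Derives T (A :: Γ) B → Derives T Γ (A →ₒ B)
  | impE {Γ : List Fml} {A B : Fml} : Derives T Γ (A →ₒ B) → Derives T Γ A → Derives T Γ B
  | raa {Γ : List Fml} {A : Fml} : Derives T ((¬ₒA) :: Γ) Fml.bot → Derives T Γ A
  | allNI {Γ : List Fml} {A : Fml} : Derives T (Γ.map Fml.liftN) A → Derives T Γ (allN A)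
  | allNE {Γ : List Fml} {A : Fml} (t : Tm) : Derives T Γ (allN A) → Derives T Γ (A.instN t)
  | allSI {Γ : List Fml} {A : Fml} : Derives T (Γ.map Fml.liftS) A → Derives T Γ (allS A)
  | allSE {Γ : List Fml} {A : Fml} (Y : ℕ) : Derives T Γ (allS A) → Derives T Γ (A.instS Y)
  | eqRefl {Γ : List Fml} (t : Tm) : Derives T Γ (t =ₒ t)
  | eqSubst {Γ : List Fml} {s t : Tm} (A : Fml) :
      Derives T Γ (s =ₒ t) → Derives T Γ (A.instN s) → Derives T Γ (A.instN t)

/-- The theory `T` proves `A`. -/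
def Proves (T : Set Fml) (A : Fml) : Prop := Derives T [] A

/-! ## Formula classes and `RCA₀` -/

/-- Bounded quantifier formulas (set parameters allowed, no set quantifiers). -/
inductive Sigma00 : Fml → Prop
  | eq (s t : Tm) : Sigma00 (s =ₒ t)
  | lt (s t : Tm) : Sigma00 (s <ₒ t)
  | mem (t : Tm) (X : ℕ) : Sigma00 (t ∈ₒ X)
  | bot : Sigma00 Fml.bot
  | imp {A B : Fml} : Sigma00 A → Sigma00 B → Sigma00 (A →ₒ B)
  | ball (t : Tm) {A : Fml} : Sigma00 A → Sigma00 (ballN t A)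

/-- `∃ m θ` with `θ` a bounded quantifier formula. -/
def Sigma01 (A : Fml) : Prop := ∃ B : Fml, Sigma00 B ∧ A = exN B

/-- `∀ m θ` with `θ` a bounded quantifier formula. -/
def Pi01 (A : Fml) : Prop := ∃ B : Fml, Sigma00 B ∧ A = allN B

/-- The basic axioms (with `m` = `v 0` and `n` = `v 1`). -/
inductive BasicAxiom : Fml → Prop
  | succ_ne_zero : BasicAxiom (¬ₒ(v 0 + 1 =ₒ 0))
  | succ_inj : BasicAxiom (v 0 + 1 =ₒ v 1 + 1 →ₒ v 0 =ₒ v 1)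
  | add_zero : BasicAxiom (v 0 + 0 =ₒ v 0)
  | add_succ : BasicAxiom (v 0 + (v 1 + 1) =ₒ (v 0 + v 1) + 1)
  | mul_zero : BasicAxiom (v 0 * 0 =ₒ 0)
  | mul_succ : BasicAxiom (v 0 * (v 1 + 1) =ₒ v 0 * v 1 + v 0)
  | not_lt_zero : BasicAxiom (¬ₒ(v 0 <ₒ 0))
  | lt_succ : BasicAxiom (v 0 <ₒ v 1 + 1 ↔ₒ (v 0 <ₒ v 1 ∨ₒ v 0 =ₒ v 1))

/-- Induction for `A(n)`, with `n` = `v 0`; all other variables are parameters. -/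
def inductionFor (A : Fml) : Fml :=
  (A.instN 0 ∧ₒ allN (A →ₒ A.app 1 (v 0 + 1))) →ₒ allN A

/-- `∀ n (A(n) ↔ B(n)) → ∃ X ∀ n (n ∈ X ↔ A(n))`, with `n` = `v 0` and `X` not free in `A`. -/
def deltaComprehensionFor (A B : Fml) : Fml :=
  allN (A ↔ₒ B) →ₒ exS (allN (v 0 ∈ₒ 0 ↔ₒ A.liftS))

/-- `RCA₀`: basic axioms, `Σ⁰₁` induction and `Δ⁰₁` comprehension. -/
inductive RCA0Axiom : Fml → Prop
  | basic {A : Fml} : BasicAxiom A → RCA0Axiom A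
  | induction {A : Fml} : Sigma01 A → RCA0Axiom (inductionFor A)
  | comprehension {A B : Fml} : Sigma01 A → Pi01 B → RCA0Axiom (deltaComprehensionFor A B)

def RCA0 : Set Fml := {A | RCA0Axiom A}

/-! ## Pairs, functions, codes of finite sets and of finite sequences -/

/-- The pair `(s, t) = (s + t)² + s`. -/
def pair (s t : Tm) : Tm := (s + t) * (s + t) + s

/-- `f : D → C`, where the classes `D` and `C` are given by formulas with distinguished number
variable `0`: `f` is a set of pairs `(i, j)` with `D(i)` and `C(j)` such that for every `i` with
`D(i)` there is exactly one `j` with `(i, j) ∈ f`. -/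
def isFun (f : ℕ) (D C : Fml) : Fml :=
  allN (v 0 ∈ₒ f →ₒ exN (exN (v 2 =ₒ pair (v 1) (v 0) ∧ₒ D.app 3 (v 1) ∧ₒ C.app 3 (v 0)))) ∧ₒ
  allN (D →ₒ exN (pair (v 1) (v 0) ∈ₒ f)) ∧ₒ
  allN (allN (allN (pair (v 2) (v 1) ∈ₒ f →ₒ pair (v 2) (v 0) ∈ₒ f →ₒ v 1 =ₒ v 0)))

/-- `f : ℕ → ℕ`. -/
def isFunNN (f : ℕ) : Fml := isFun f Fml.top Fml.top

/-- `f : ℕ → [n]`, where `[n] = {j : j ≤ n}`. -/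
def isFunTo (f : ℕ) (n : Tm) : Fml := isFun f Fml.top (le (v 0) (n.lift 1))

/-- `f : [k] → [n]`. -/
def isFunFin (f : ℕ) (k n : Tm) : Fml := isFun f (le (v 0) (k.lift 1)) (le (v 0) (n.lift 1))

/-- `X` is finite, i.e. bounded. -/
def isFinite (X : ℕ) : Fml := exN (allN (v 0 ∈ₒ X →ₒ v 0 <ₒ v 1))

/-- `X` is infinite. -/
def isInfinite (X : ℕ) : Fml := ¬ₒ(isFinite X)

/-- `c` has the form `(k, (m, n))`. -/
def isTriple (c : Tm) : Fml :=
  bexN (c + 1) (bexN (c.lift 1 + 1) (bexN (c.lift 2 + 1)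
    (c.lift 3 =ₒ pair (v 2) (pair (v 1) (v 0)))))

/-- `i` belongs to the finite set described by `c`: `c = (k, (m, n))` for some `k`, `m`, `n` with
`i < k` and `m(i + 1) + 1` dividing `n`. -/
def inCode (i c : Tm) : Fml :=
  bexN (c + 1) (bexN (c.lift 1 + 1) (bexN (c.lift 2 + 1)
    (c.lift 3 =ₒ pair (v 2) (pair (v 1) (v 0)) ∧ₒ i.lift 3 <ₒ v 2 ∧ₒ
      bexN (v 0 + 1) ((v 2 * (i.lift 4 + 1) + 1) * v 0 =ₒ v 1))))

/-- `c` is the code of a finite set: the least number `(k, (m, n))` which describes that set. (All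
elements of sets described by numbers `≤ c` are `< c`.) -/
def isFinCode (c : Tm) : Fml :=
  isTriple c ∧ₒ
  ballN c (isTriple (v 0) →ₒ
    ¬ₒ(ballN (c.lift 1) (inCode (v 0) (v 1) ↔ₒ inCode (v 0) (c.lift 2))))

/-- `s(i) = b`, for a (code of a) finite sequence `s`: the pair `(i, b)` belongs to the finite set
coded by `s`. -/
def valIs (s i b : Tm) : Fml := inCode (pair i b) s

/-- `lh s = l`: the indices `a` at which `s` has a value are exactly the `a < l`. (Only `a ≤ s` have
to be considered.) -/
def lhIs (s l : Tm) : Fml :=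
  ballN (s + 1) (v 0 <ₒ l.lift 1 ↔ₒ bexN (s.lift 1 + 1) (valIs (s.lift 2) (v 1) (v 0)))

/-- `s ∈ Seq`: `s` is the code of a finite set of pairs which is a function with domain
`{a : a < l}` for some `l`. (All elements of that set are `< s`.) -/
def isSeq (s : Tm) : Fml :=
  isFinCode s ∧ₒ
  ballN s (inCode (v 0) (s.lift 1) →ₒ
    bexN (s.lift 1) (bexN (s.lift 2) (v 2 =ₒ pair (v 1) (v 0)))) ∧ₒ
  bexN (s + 1) (lhIs (s.lift 1) (v 0)) ∧ₒ
  ballN s (ballN (s.lift 1) (ballN (s.lift 2)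
    (valIs (s.lift 3) (v 2) (v 1) →ₒ valIs (s.lift 3) (v 2) (v 0) →ₒ v 1 =ₒ v 0)))

/-- `x ∈ A_l`, where `A_l = {l(i) : i < lh l}` for `l ∈ Seq`. -/
def inA (x l : Tm) : Fml :=
  bexN l (exN (lhIs (l.lift 2) (v 0) ∧ₒ v 1 <ₒ v 0) ∧ₒ valIs (l.lift 1) (v 0) (x.lift 1))

/-- `|A_l| = m`: there is a bijection from `{i : i < m}` to `A_l`. -/
def cardIs (l m : Tm) : Fml :=
  exS (isFun 0 (v 0 <ₒ m.lift 1) (inA (v 0) (l.lift 1)) ∧ₒ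
    allN (allN (allN (pair (v 2) (v 0) ∈ₒ 0 →ₒ pair (v 1) (v 0) ∈ₒ 0 →ₒ v 2 =ₒ v 1))) ∧ₒ
    allN (inA (v 0) (l.lift 1) →ₒ exN (pair (v 0) (v 1) ∈ₒ 0)))

/-- `|A_l| > m`. -/
def cardGt (l m : Tm) : Fml := exN (cardIs (l.lift 1) (v 0) ∧ₒ m.lift 1 <ₒ v 0)

/-- `|A_l| > F(l)`, for a function `F`. -/
def cardGtVal (F : ℕ) (l : Tm) : Fml := exN (pair (l.lift 1) (v 0) ∈ₒ F ∧ₒ cardGt (l.lift 1) (v 0))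

/-- `F(s) = F(t)`, for a function `F`. -/
def sameVal (F : ℕ) (s t : Tm) : Fml :=
  exN (pair (s.lift 1) (v 0) ∈ₒ F ∧ₒ pair (t.lift 1) (v 0) ∈ₒ F)

/-- `s` is the code of the finite sequence `⟨f(0), …, f(y - 1)⟩`, for a function `f`. -/
def isInit (s : Tm) (f : ℕ) (y : Tm) : Fml :=
  isSeq s ∧ₒ lhIs s y ∧ₒ
  ballN y (allN (valIs (s.lift 2) (v 1) (v 0) →ₒ pair (v 1) (v 0) ∈ₒ f))

/-- The codes of `⟨f(0), …, f(y - 1)⟩` and of `⟨g(0), …, g(y - 1)⟩` are equal. -/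
def agree (f g : ℕ) (y : Tm) : Fml :=
  exN (isInit (v 0) f (y.lift 1) ∧ₒ isInit (v 0) g (y.lift 1))

/-! ## Asymptotic stability -/

/-- `F` is extensional: for all `l, l' ∈ Seq`, if `A_l = A_{l'}` then `F(l) = F(l')`. -/
def isExtensional (F : ℕ) : Fml :=
  allN (allN (isSeq (v 1) →ₒ isSeq (v 0) →ₒ
    allN (inA (v 0) (v 2) ↔ₒ inA (v 0) (v 1)) →ₒ sameVal F (v 1) (v 0)))

/-- `x ∈ A_{l_m}`, for a sequence `L = (l_m)`. -/
def inAof (x : Tm) (L : ℕ) (m : Tm) : Fml :=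
  exN (pair (m.lift 1) (v 0) ∈ₒ L ∧ₒ inA (x.lift 1) (v 0))

/-- `L = (l_m)` is a sequence of numbers with `l_m ∈ Seq` for all `m`. -/
def isSeqOfSeqs (L : ℕ) : Fml :=
  isFunNN L ∧ₒ allN (allN (pair (v 1) (v 0) ∈ₒ L →ₒ isSeq (v 0)))

/-- `L = (l_m)` is a nested sequence with union: `l_m ∈ Seq` and `A_{l_m} ⊆ A_{l_{m+1}}` for all
`m`, and there is a set `U = ⋃ₘ A_{l_m}`. -/
def isNestedWithUnion (L : ℕ) : Fml :=
  isSeqOfSeqs L ∧ₒ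
  allN (allN (inAof (v 0) L (v 1) →ₒ inAof (v 0) L (v 1 + 1))) ∧ₒ
  exS (allN (v 0 ∈ₒ 0 ↔ₒ exN (inAof (v 1) (L + 1) (v 0))))

/-- `L = (l_m)` weakly converges to the infinite set `A`: `l_m ∈ Seq` for all `m`, and for every
finite set `B` there is an `i` with `A_{l_j} ∩ B = A ∩ B` for all `j ≥ i`. -/
def weaklyConvergesTo (L A : ℕ) : Fml :=
  isInfinite A ∧ₒ isSeqOfSeqs L ∧ₒ
  allS (isFinite 0 →ₒ exN (allN (le (v 1) (v 0) →ₒ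
    allN ((inAof (v 0) (L + 1) (v 1) ∧ₒ v 0 ∈ₒ 0) ↔ₒ (v 0 ∈ₒ (A + 1) ∧ₒ v 0 ∈ₒ 0)))))

/-- `L = (l_m)` weakly converges to some infinite set. -/
def weaklyConverges (L : ℕ) : Fml := exS (weaklyConvergesTo (L + 1) 0)

/-- There is an `i` with `F(l_i) = F(l_j)` for all `j ≥ i`, where `L = (l_m)`. -/
def stabilizes (F L : ℕ) : Fml :=
  exN (allN (le (v 1) (v 0) →ₒ
    exN (exN (pair (v 3) (v 1) ∈ₒ L ∧ₒ pair (v 2) (v 0) ∈ₒ L ∧ₒ sameVal F (v 1) (v 0)))))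

/-- `F` is asymptotically stable. -/
def isAS (F : ℕ) : Fml :=
  isFunNN F ∧ₒ isExtensional F ∧ₒ allS (isNestedWithUnion 0 →ₒ stabilizes (F + 1) 0)

/-- `F` is asymptotically stable near infinite sets. -/
def isASNIS (F : ℕ) : Fml :=
  isFunNN F ∧ₒ isExtensional F ∧ₒ allS (weaklyConverges 0 →ₒ stabilizes (F + 1) 0)

/-! ## The pigeonhole principles -/

/-- `∀ n ∀ f : ℕ → [n] ∃ c ∈ [n] (f⁻¹(c) is infinite)`. -/
def IPP : Fml :=
  allN (allS (isFunTo 0 (v 0) →ₒ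
    exN (le (v 0) (v 1) ∧ₒ
      exS (allN (v 0 ∈ₒ 0 ↔ₒ pair (v 0) (v 1) ∈ₒ 1) ∧ₒ isInfinite 0))))

/-- `∀ n ∀ F ∈ AS ∃ k ∀ f : [k] → [n] ∃ l ∈ Seq (A_l ⊆ [k] ∧ |A_l| > F(l) ∧ f is constant on A_l)`.
-/
def FIPP2 : Fml :=
  allN (allS (isAS 0 →ₒ
    exN (allS (isFunFin 0 (v 0) (v 1) →ₒ
      exN (isSeq (v 0) ∧ₒ
        allN (inA (v 0) (v 1) →ₒ le (v 0) (v 2)) ∧ₒ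
        cardGtVal 1 (v 0) ∧ₒ
        allN (allN (inA (v 1) (v 2) →ₒ inA (v 0) (v 2) →ₒ sameVal 0 (v 1) (v 0))))))))

/-- `∀ n ∀ F ∈ ASNIS ∃ k ∀ f : [k] → [n] ∃ l ∈ Seq ∃ c ∈ [n] (A_l = f⁻¹(c) ∧ |A_l| > F(l))`. -/
def FIPP3 : Fml :=
  allN (allS (isASNIS 0 →ₒ
    exN (allS (isFunFin 0 (v 0) (v 1) →ₒ
      exN (isSeq (v 0) ∧ₒ exN (le (v 0) (v 3) ∧ₒ
        allN (inA (v 0) (v 2) ↔ₒ pair (v 0) (v 1) ∈ₒ 0) ∧ₒ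
        cardGtVal 1 (v 1)))))))

/-! ## Continuous uniform boundedness

In a formula `A(f, x₁, …, x_p)` the distinguished set variable `f` is set variable `0` and the
distinguished number variables are `v 0, …, v (p - 1)`; all other variables are parameters. -/

/-- `∀ x₁ … ∀ x_p A`. -/
def allBlock : ℕ → Fml → Fml
  | 0, A => A
  | p + 1, A => allN (allBlock p A)

/-- `∃ x₁ … ∃ x_p A`. -/
def exBlock : ℕ → Fml → Fml
  | 0, A => A
  | p + 1, A => exN (exBlock p A)

/-- `x₁ ≤ t ∧ … ∧ x_p ≤ t`. -/
def blockLe : ℕ → Tm → Fml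
  | 0, _ => Fml.top
  | p + 1, t => blockLe p t ∧ₒ le (v p) t

/-- `A(f, x₁, …, x_p)` placed where `d` further number quantifiers stand between the parameters and
`x₁, …, x_p`, and where the set variables are renamed by `ρ`. -/
def place (p d : ℕ) (ρ : ℕ → ℕ) (A : Fml) : Fml :=
  A.subst (fun i => if i < p then v i else v (i + d)) ρ

/-- `cont(A)`, where `n` = `v 0` is not free in `A`:
`∀ f : ℕ → [n] ∀ z ∃ y ∀ g : ℕ → [n]`
`(f̄ y = ḡ y → ∀ x₁, …, x_p ≤ z (A(f, x₁, …, x_p) ↔ A(g, x₁, …, x_p)))`.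
Under the quantifiers, `g` is set variable `0`, `f` is set variable `1`, and `y`, `z`, `n` are the
number variables `p`, `p + 1`, `p + 2`. -/
def cont (p : ℕ) (A : Fml) : Fml :=
  allS (isFunTo 0 (v 0) →ₒ allN (exN (allS (isFunTo 0 (v 2) →ₒ agree 1 0 (v 0) →ₒ
    allBlock p (blockLe p (v (p + 1)) →ₒ
      (place p 3 (fun X => X + 1) A ↔ₒ
       place p 3 (fun | 0 => 0 | X + 1 => X + 2) A))))))

/-- The instance of continuous uniform boundedness for `A(f, x₁, …, x_p)`:
`∀ n ((cont(A) ∧ ∀ f : ℕ → [n] ∃ x₁, …, x_p A(f, x₁, …, x_p)) →`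
`∃ z ∀ f : ℕ → [n] ∃ x₁, …, x_p ≤ z A(f, x₁, …, x_p))`. -/
def cubFor (p : ℕ) (A : Fml) : Fml :=
  allN ((cont p A ∧ₒ allS (isFunTo 0 (v 0) →ₒ exBlock p (place p 1 id A))) →ₒ
    exN (allS (isFunTo 0 (v 1) →ₒ exBlock p (blockLe p (v p) ∧ₒ place p 2 id A))))

/-- The schema `Φ`-`CUB` for a class `Φ` of formulas. -/
def CUB (Φ : Fml → Prop) : Set Fml := {C | ∃ (p : ℕ) (A : Fml), Φ A ∧ C = cubFor p A}

end SOA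

/-!
The proof is semantic. The natural deduction calculus is complete for countable general models, in
which number variables range over a set `M` with `0, 1, +, *, <` and set variables over a family
`S` of subsets of `M` (`proves_of_sat`; Henkin's construction, with the free variables as
witnesses). So it suffices to show that a countable model of `RCA₀` and of the relevant instances of
uniform boundedness which satisfies the infinite pigeonhole principle also satisfies its finitary
versions. In such a model the numbers form a discretely ordered semiring (`Model.numbers`), bounded
conditions with parameters satisfy `Σ⁰₁` induction, collection and `Δ⁰₁` comprehension, and bounded
sets and finite sequences have codes (`Model.exists_finCode`, `Model.exists_seq`). The coding by
divisors `m (i + 1) + 1` works as usual for Gödel's `β` function, with `m` a common multiple of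
`1, …, k`.

For the first principle, uniform boundedness is applied to the bounded condition on `f`, `l` and `c`
that `l` is an increasing sequence of color `c` which is longer than `F(l)`. It depends only on
the colors of numbers below `l`, so it is continuous. Given `f : ℕ → [n]`, the infinite pigeonhole
principle gives an infinite color class `A`; the lists of `A ∩ {0, …, m - 1}` form a nested
sequence with union `A`, so `F` is eventually constant on them while their lengths are unbounded
(`Model.exists_largeOfColor`). The bound `z` for `l` and `c` serves as `k`.

For the second principle, it is applied to the `Π⁰₁` condition on `f` and `k` that no finite coloring
`s` prolonging the initial segment of length `k` of `f` has only color classes with at most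
`F(class)` elements. It depends only on that initial segment, so it is trivially continuous. If it
failed for some `f` and all `k`, choose such an `s` for every `k`, and let `A` be an infinite
color class of `f`: the classes of the same color under the chosen colorings converge weakly to `A`,
so `F` is eventually constant on them, which bounds their sizes, but they contain longer and longer
initial parts of `A` (`Model.exists_no_smallClasses`). By uniform boundedness, a coloring of `[z]`
prolongs some initial segment for which the condition holds.
-/

namespace SOA

/-! ### Substitution -/

/-- The sequence with first entry `x`, followed by the entries of `e`. -/
def scons {α : Type*} (x : α) (e : ℕ → α) : ℕ → α
  | 0 => x
  | i + 1 => e i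

@[simp] theorem scons_zero {α : Type*} (x : α) (e : ℕ → α) : scons x e 0 = x := rfl
@[simp] theorem scons_succ {α : Type*} (x : α) (e : ℕ → α) (i : ℕ) :
    scons x e (i + 1) = e i := rfl

theorem eq_scons {α : Type*} {f e : ℕ → α} {x : α} (h0 : f 0 = x) (hs : ∀ i, f (i + 1) = e i) :
    f = scons x e := by
  funext i
  cases i with
  | zero => exact h0
  | succ i => exact hs i

namespace Tm

theorem subst_subst (t : Tm) (σ τ : ℕ → Tm) :
    (t.subst σ).subst τ = t.subst fun i => (σ i).subst τ := by
  induction t with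
  | var i => rfl
  | zero => rfl
  | one => rfl
  | add s t hs ht => simp only [subst, hs, ht]
  | mul s t hs ht => simp only [subst, hs, ht]

theorem subst_v (t : Tm) : t.subst v = t := by
  induction t with
  | var i => rfl
  | zero => rfl
  | one => rfl
  | add s t hs ht => simp only [subst, hs, ht]
  | mul s t hs ht => simp only [subst, hs, ht]

theorem lift_subst_scons (t s : Tm) (σ : ℕ → Tm) : (t.lift 1).subst (scons s σ) = t.subst σ := by
  rw [lift, subst_subst]
  rfl

theorem subst_lift (t : Tm) (σ : ℕ → Tm) (k : ℕ) :
    (t.subst σ).lift k = t.subst fun i => (σ i).lift k := subst_subst _ _ _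

/-- Substitution depends only on finitely many variables. -/
theorem exists_bound (t : Tm) :
    ∃ N, ∀ σ τ : ℕ → Tm, (∀ i < N, σ i = τ i) → t.subst σ = t.subst τ := by
  induction t with
  | var i => exact ⟨i + 1, fun σ τ h => h i (Nat.lt_succ_self i)⟩
  | zero => exact ⟨0, fun _ _ _ => rfl⟩
  | one => exact ⟨0, fun _ _ _ => rfl⟩
  | add s t hs ht =>
    obtain ⟨N, hN⟩ := hs
    obtain ⟨K, hK⟩ := ht
    refine ⟨max N K, fun σ τ h => ?_⟩
    simp only [subst, hN σ τ fun i hi => h i (lt_max_of_lt_left hi),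
      hK σ τ fun i hi => h i (lt_max_of_lt_right hi)]
  | mul s t hs ht =>
    obtain ⟨N, hN⟩ := hs
    obtain ⟨K, hK⟩ := ht
    refine ⟨max N K, fun σ τ h => ?_⟩
    simp only [subst, hN σ τ fun i hi => h i (lt_max_of_lt_left hi),
      hK σ τ fun i hi => h i (lt_max_of_lt_right hi)]

end Tm

/-- The substitution `σ` moved under a number quantifier. -/
def up (σ : ℕ → Tm) : ℕ → Tm := scons (v 0) fun i => (σ i).lift 1

/-- The renaming `ρ` moved under a set quantifier. -/
def upS (ρ : ℕ → ℕ) : ℕ → ℕ := scons 0 fun i => ρ i + 1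

namespace Fml

theorem subst_allN (σ : ℕ → Tm) (ρ : ℕ → ℕ) (A : Fml) :
    (allN A).subst σ ρ = allN (A.subst (up σ) ρ) := by
  rw [subst]
  congr 2

theorem subst_allS (σ : ℕ → Tm) (ρ : ℕ → ℕ) (A : Fml) :
    (allS A).subst σ ρ = allS (A.subst σ (upS ρ)) := by
  rw [subst]
  congr 2

theorem instN_eq (A : Fml) (t : Tm) : A.instN t = A.subst (scons t v) id := by
  rw [instN]
  congr 1

theorem instS_eq (A : Fml) (Y : ℕ) : A.instS Y = A.subst v (scons Y id) := by
  rw [instS]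
  congr 1

theorem app_eq (A : Fml) (k : ℕ) (t : Tm) :
    A.app k t = A.subst (scons t fun i => v (i + k)) id := by
  rw [app]
  congr 1

theorem up_v : up v = v := (eq_scons rfl fun _ => rfl).symm

theorem upS_id : upS id = id := (eq_scons (f := id) rfl fun _ => rfl).symm

theorem subst_id (A : Fml) : A.subst v id = A := by
  induction A with
  | eq s t => simp only [subst, Tm.subst_v]
  | lt s t => simp only [subst, Tm.subst_v]
  | mem t X => simp only [subst, Tm.subst_v, id]
  | bot => rfl
  | imp A B hA hB => simp only [subst, hA, hB]
  | allN A hA => rw [subst_allN, up_v, hA]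
  | allS A hA => rw [subst_allS, upS_id, hA]

theorem up_subst_up (σ τ : ℕ → Tm) :
    (fun i => (up σ i).subst (up τ)) = up fun i => (σ i).subst τ := by
  refine eq_scons rfl fun i => ?_
  change ((σ i).lift 1).subst (up τ) = ((σ i).subst τ).lift 1
  rw [up, Tm.lift_subst_scons, Tm.subst_lift]

theorem upS_comp (ρ π : ℕ → ℕ) : upS π ∘ upS ρ = upS (π ∘ ρ) :=
  eq_scons rfl fun _ => rfl

theorem subst_subst (A : Fml) (σ τ : ℕ → Tm) (ρ π : ℕ → ℕ) :
    (A.subst σ ρ).subst τ π = A.subst (fun i => (σ i).subst τ) (π ∘ ρ) := by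
  induction A generalizing σ τ ρ π with
  | eq s t => simp only [subst, Tm.subst_subst]
  | lt s t => simp only [subst, Tm.subst_subst]
  | mem t X => simp only [subst, Tm.subst_subst, Function.comp]
  | bot => rfl
  | imp A B hA hB => simp only [subst, hA, hB]
  | allN A hA => rw [subst_allN, subst_allN, subst_allN, hA, up_subst_up]
  | allS A hA => rw [subst_allS, subst_allS, subst_allS, hA, upS_comp]

theorem liftN_subst_up (A : Fml) (σ : ℕ → Tm) (ρ : ℕ → ℕ) :
    A.liftN.subst (up σ) ρ = (A.subst σ ρ).liftN := by
  rw [liftN, liftN, subst_subst, subst_subst]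
  rfl

theorem liftS_subst_upS (A : Fml) (σ : ℕ → Tm) (ρ : ℕ → ℕ) :
    A.liftS.subst σ (upS ρ) = (A.subst σ ρ).liftS := by
  rw [liftS, liftS, subst_subst, subst_subst]
  simp only [Tm.subst_v]
  rfl

theorem subst_up_instN (A : Fml) (σ : ℕ → Tm) (ρ : ℕ → ℕ) (t : Tm) :
    (A.subst (up σ) ρ).instN t = A.subst (scons t σ) ρ := by
  rw [instN_eq, subst_subst]
  congr 1
  refine eq_scons rfl fun i => ?_
  change ((σ i).lift 1).subst (scons t v) = σ i
  rw [Tm.lift_subst_scons, Tm.subst_v]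

theorem instN_subst (A : Fml) (σ : ℕ → Tm) (ρ : ℕ → ℕ) (t : Tm) :
    (A.instN t).subst σ ρ = (A.subst (up σ) ρ).instN (t.subst σ) := by
  rw [subst_up_instN, instN_eq, subst_subst]
  congr 1
  exact eq_scons rfl fun _ => rfl

theorem subst_upS_instS (A : Fml) (σ : ℕ → Tm) (ρ : ℕ → ℕ) (Y : ℕ) :
    (A.subst σ (upS ρ)).instS Y = A.subst σ (scons Y ρ) := by
  rw [instS_eq, subst_subst]
  simp only [Tm.subst_v]
  congr 1
  exact eq_scons rfl fun _ => rfl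

theorem instS_subst (A : Fml) (σ : ℕ → Tm) (ρ : ℕ → ℕ) (Y : ℕ) :
    (A.instS Y).subst σ ρ = (A.subst σ (upS ρ)).instS (ρ Y) := by
  rw [subst_upS_instS, instS_eq, subst_subst]
  congr 1
  exact eq_scons rfl fun _ => rfl

/-- Substitution depends only on finitely many variables. -/
theorem exists_bound (A : Fml) :
    ∃ N, ∀ (σ τ : ℕ → Tm) (ρ π : ℕ → ℕ), (∀ i < N, σ i = τ i) → (∀ i < N, ρ i = π i) →
      A.subst σ ρ = A.subst τ π := by
  induction A with
  | eq s t =>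
    obtain ⟨N, hN⟩ := s.exists_bound
    obtain ⟨K, hK⟩ := t.exists_bound
    refine ⟨max N K, fun σ τ ρ π h _ => ?_⟩
    simp only [subst, hN σ τ fun i hi => h i (lt_max_of_lt_left hi),
      hK σ τ fun i hi => h i (lt_max_of_lt_right hi)]
  | lt s t =>
    obtain ⟨N, hN⟩ := s.exists_bound
    obtain ⟨K, hK⟩ := t.exists_bound
    refine ⟨max N K, fun σ τ ρ π h _ => ?_⟩
    simp only [subst, hN σ τ fun i hi => h i (lt_max_of_lt_left hi),
      hK σ τ fun i hi => h i (lt_max_of_lt_right hi)]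
  | mem t X =>
    obtain ⟨N, hN⟩ := t.exists_bound
    refine ⟨max N (X + 1), fun σ τ ρ π h h' => ?_⟩
    simp only [subst, hN σ τ fun i hi => h i (lt_max_of_lt_left hi),
      h' X (lt_max_of_lt_right (Nat.lt_succ_self X))]
  | bot => exact ⟨0, fun _ _ _ _ _ _ => rfl⟩
  | imp A B hA hB =>
    obtain ⟨N, hN⟩ := hA
    obtain ⟨K, hK⟩ := hB
    refine ⟨max N K, fun σ τ ρ π h h' => ?_⟩
    simp only [subst, hN σ τ ρ π (fun i hi => h i (lt_max_of_lt_left hi))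
        fun i hi => h' i (lt_max_of_lt_left hi),
      hK σ τ ρ π (fun i hi => h i (lt_max_of_lt_right hi))
        fun i hi => h' i (lt_max_of_lt_right hi)]
  | allN A hA =>
    obtain ⟨N, hN⟩ := hA
    refine ⟨N, fun σ τ ρ π h h' => ?_⟩
    rw [subst_allN, subst_allN, hN (up σ) (up τ) ρ π ?_ h']
    rintro (_ | i) hi
    · rfl
    · simp only [up, scons_succ, h i (by omega)]
  | allS A hA =>
    obtain ⟨N, hN⟩ := hA
    refine ⟨N, fun σ τ ρ π h h' => ?_⟩
    rw [subst_allS, subst_allS, hN σ τ (upS ρ) (upS π) h ?_]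
    rintro (_ | i) hi
    · rfl
    · simp only [upS, scons_succ, h' i (by omega)]

theorem exists_bound_list (Γ : List Fml) :
    ∃ N, ∀ A ∈ Γ, ∀ (σ τ : ℕ → Tm) (ρ π : ℕ → ℕ), (∀ i < N, σ i = τ i) →
      (∀ i < N, ρ i = π i) → A.subst σ ρ = A.subst τ π := by
  induction Γ with
  | nil => exact ⟨0, fun A hA => by simp at hA⟩
  | cons B Γ ih =>
    obtain ⟨N, hN⟩ := ih
    obtain ⟨K, hK⟩ := B.exists_bound
    refine ⟨max N K, fun A hA σ τ ρ π h h' => ?_⟩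
    rcases List.mem_cons.1 hA with rfl | hA
    · exact hK _ _ _ _ (fun i hi => h i (lt_max_of_lt_right hi))
        fun i hi => h' i (lt_max_of_lt_right hi)
    · exact hN A hA _ _ _ _ (fun i hi => h i (lt_max_of_lt_left hi))
        fun i hi => h' i (lt_max_of_lt_left hi)

end Fml

/-! ### Structural properties of derivability -/

namespace Derives

variable {T : Set Fml}

theorem weaken {Γ Δ : List Fml} {A : Fml} (h : Derives T Γ A) (hs : Γ ⊆ Δ) : Derives T Δ A := by
  induction h generalizing Δ with
  | ax h => exact .ax h
  | hyp h => exact .hyp (hs h)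
  | impI _ ih => exact .impI (ih (List.cons_subset_cons _ hs))
  | impE _ _ ih1 ih2 => exact .impE (ih1 hs) (ih2 hs)
  | raa _ ih => exact .raa (ih (List.cons_subset_cons _ hs))
  | allNI _ ih => exact .allNI (ih (List.map_subset _ hs))
  | allNE t _ ih => exact .allNE t (ih hs)
  | allSI _ ih => exact .allSI (ih (List.map_subset _ hs))
  | allSE Y _ ih => exact .allSE Y (ih hs)
  | eqRefl t => exact .eqRefl t
  | eqSubst A _ _ ih1 ih2 => exact .eqSubst A (ih1 hs) (ih2 hs)

/-- Instances of axioms are derivable: the variables are generalized and instantiated one after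
the other. While variable `k` is being instantiated, the terms already substituted are still to
pass through `N - k` instantiations, so they are lifted that often. -/
theorem subst_of_forall {A : Fml} (hA : ∀ Γ, Derives T Γ A) (σ : ℕ → Tm) (ρ : ℕ → ℕ)
    (Γ : List Fml) : Derives T Γ (A.subst σ ρ) := by
  obtain ⟨N, hN⟩ := A.exists_bound
  have numbers : ∀ k ≤ N, ∀ Γ, Derives T Γ
      (A.subst (fun i => if i < k then (σ i).lift (N - k) else v (i - k)) id) := by
    intro k
    induction k with
    | zero =>
      intro _ Γ
      simpa using (A.subst_id.symm ▸ hA Γ : Derives T Γ (A.subst v id))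
    | succ k ih =>
      intro hk Γ
      have h := Derives.allNE ((σ k).lift (N - (k + 1))) (allNI (ih (by omega) (Γ.map Fml.liftN)))
      rw [Fml.instN_eq, Fml.subst_subst, Function.comp_id] at h
      convert h using 2
      funext i
      rcases lt_trichotomy i k with hi | rfl | hi
      · obtain ⟨d, hd⟩ : ∃ d, N - k = d + 1 := ⟨N - k - 1, by omega⟩
        simp only [hi, Nat.lt_succ_of_lt hi, if_true, hd, show N - (k + 1) = d by omega, Tm.lift,
          Tm.subst_subst]
        rfl
      · simp [Tm.subst]
      · obtain ⟨d, rfl⟩ := Nat.exists_eq_add_of_lt hi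
        simp only [show ¬ k + d + 1 < k + 1 by omega, show ¬ k + d + 1 < k by omega, if_false,
          show k + d + 1 - (k + 1) = d by omega, show k + d + 1 - k = d + 1 by omega, Tm.subst,
          scons_succ]
  have sets : ∀ k ≤ N, ∀ Γ, Derives T Γ
      (A.subst (fun i => if i < N then σ i else v (i - N))
        (fun i => if i < k then ρ i + (N - k) else i - k)) := by
    intro k
    induction k with
    | zero =>
      intro _ Γ
      have h := numbers N le_rfl Γ
      simp only [Nat.sub_self] at h
      convert h using 2
      · funext i
        split_ifs
        · exact (Tm.subst_v _).symm
        · rfl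
      · funext i
        simp
    | succ k ih =>
      intro hk Γ
      have h := Derives.allSE (ρ k + (N - (k + 1))) (allSI (ih (by omega) (Γ.map Fml.liftS)))
      rw [Fml.instS_eq, Fml.subst_subst] at h
      simp only [Tm.subst_v] at h
      convert h using 2
      funext i
      rcases lt_trichotomy i k with hi | rfl | hi
      · simp only [hi, Nat.lt_succ_of_lt hi, if_true, Function.comp,
          show ρ i + (N - k) = ρ i + (N - (k + 1)) + 1 by omega, scons_succ, id]
      · simp
      · obtain ⟨d, rfl⟩ := Nat.exists_eq_add_of_lt hi
        simp only [show ¬ k + d + 1 < k + 1 by omega, show ¬ k + d + 1 < k by omega, if_false,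
          show k + d + 1 - (k + 1) = d by omega, show k + d + 1 - k = d + 1 by omega, Function.comp,
          scons_succ, id]
  have h := sets N le_rfl Γ
  rwa [hN _ σ _ ρ (fun i hi => if_pos hi) fun i hi => by simp [hi]] at h

theorem subst {Γ : List Fml} {A : Fml} (h : Derives T Γ A) (σ : ℕ → Tm) (ρ : ℕ → ℕ) :
    Derives T (Γ.map (Fml.subst σ ρ)) (A.subst σ ρ) := by
  induction h generalizing σ ρ with
  | ax h => exact subst_of_forall (fun Γ => .ax h) _ _ _
  | hyp h => exact .hyp (List.mem_map_of_mem h)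
  | impI _ ih => exact .impI (ih σ ρ)
  | impE _ _ ih1 ih2 => exact .impE (ih1 σ ρ) (ih2 σ ρ)
  | raa _ ih => exact .raa (ih σ ρ)
  | allNI _ ih =>
    rw [Fml.subst_allN]
    refine .allNI ?_
    have h := ih (up σ) ρ
    simpa only [List.map_map, Function.comp_def, Fml.liftN_subst_up] using h
  | allNE t _ ih =>
    rw [Fml.instN_subst]
    exact .allNE _ (Fml.subst_allN σ ρ _ ▸ ih σ ρ)
  | allSI _ ih =>
    rw [Fml.subst_allS]
    refine .allSI ?_
    have h := ih σ (upS ρ)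
    simpa only [List.map_map, Function.comp_def, Fml.liftS_subst_upS] using h
  | allSE Y _ ih =>
    rw [Fml.instS_subst]
    exact .allSE _ (Fml.subst_allS σ ρ _ ▸ ih σ ρ)
  | eqRefl t => exact .eqRefl _
  | eqSubst A _ _ ih1 ih2 =>
    have h1 := ih1 σ ρ
    have h2 := ih2 σ ρ
    rw [Fml.instN_subst] at h2 ⊢
    exact .eqSubst _ h1 h2

/-- Generalization over a number variable that does not occur elsewhere. -/
theorem exists_fresh_number (Γ : List Fml) (B : Fml) :
    ∃ k, Derives T Γ (B.instN (v k)) → Derives T Γ (Fml.allN B) := by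
  obtain ⟨N, hN⟩ := Fml.exists_bound_list (Fml.allN B :: Γ)
  refine ⟨N, fun h => .allNI ?_⟩
  have h := h.subst (fun i => if i = N then v 0 else v (i + 1)) id
  have hΓ : Γ.map (Fml.subst (fun i => if i = N then v 0 else v (i + 1)) id) =
      Γ.map Fml.liftN :=
    List.map_congr_left fun A hA => hN A (List.mem_cons_of_mem _ hA) _ _ _ _
      (fun i hi => if_neg hi.ne) fun _ _ => rfl
  have hB := hN _ List.mem_cons_self (fun i => if i = N then v 0 else v (i + 1))
    (fun i => v (i + 1)) id id (fun i hi => if_neg hi.ne) fun _ _ => rfl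
  rw [Fml.subst_allN, Fml.subst_allN, Fml.allN.injEq] at hB
  rw [hΓ, Fml.instN_subst, hB, Fml.subst_up_instN] at h
  convert h
  refine B.subst_id.symm.trans ?_
  congr 1
  exact eq_scons (by simp [Tm.subst]) fun _ => rfl

/-- Generalization over a set variable that does not occur elsewhere. -/
theorem exists_fresh_set (Γ : List Fml) (B : Fml) :
    ∃ k, Derives T Γ (B.instS k) → Derives T Γ (Fml.allS B) := by
  obtain ⟨N, hN⟩ := Fml.exists_bound_list (Fml.allS B :: Γ)
  refine ⟨N, fun h => .allSI ?_⟩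
  have h := h.subst v (fun i => if i = N then 0 else i + 1)
  have hΓ : Γ.map (Fml.subst v (fun i => if i = N then 0 else i + 1)) = Γ.map Fml.liftS :=
    List.map_congr_left fun A hA => hN A (List.mem_cons_of_mem _ hA) _ _ _ _
      (fun _ _ => rfl) (fun i hi => if_neg hi.ne)
  have hB := hN _ List.mem_cons_self v v (fun i => if i = N then 0 else i + 1)
    (fun i => i + 1) (fun _ _ => rfl) (fun i hi => if_neg hi.ne)
  rw [Fml.subst_allS, Fml.subst_allS, Fml.allS.injEq] at hB
  rw [hΓ, Fml.instS_subst, hB, Fml.subst_upS_instS] at h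
  convert h
  refine B.subst_id.symm.trans ?_
  congr 1
  exact eq_scons (by simp) fun _ => rfl

theorem exfalso {Γ : List Fml} {A : Fml} (h : Derives T Γ Fml.bot) : Derives T Γ A :=
  .raa (h.weaken (List.subset_cons_self _ _))

theorem not_of_bot {Γ : List Fml} {A : Fml} (h : Derives T (A :: Γ) Fml.bot) :
    Derives T Γ (¬ₒA) := .impI h

end Derives

/-! ### General models -/

section Semantics

variable {M : Type} [Zero M] [One M] [Add M] [Mul M] [LT M]

/-- The value of a term under an assignment. -/
def Tm.eval (e : ℕ → M) : Tm → M
  | Tm.var i => e i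
  | Tm.zero => 0
  | Tm.one => 1
  | Tm.add s t => s.eval e + t.eval e
  | Tm.mul s t => s.eval e * t.eval e

/-- Truth of a formula in the general model with numbers `M` and sets `S`, under the assignments
`e` and `s`. -/
def Sat (S : Set (Set M)) : Fml → (ℕ → M) → (ℕ → Set M) → Prop
  | Fml.eq a b, e, _ => a.eval e = b.eval e
  | Fml.lt a b, e, _ => a.eval e < b.eval e
  | Fml.mem t X, e, s => t.eval e ∈ s X
  | Fml.bot, _, _ => False
  | Fml.imp A B, e, s => Sat S A e s → Sat S B e s
  | Fml.allN A, e, s => ∀ x, Sat S A (scons x e) s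
  | Fml.allS A, e, s => ∀ X ∈ S, Sat S A e (scons X s)

end Semantics

deriving instance Countable for Tm
deriving instance Countable for Fml

/-! ### Completeness -/

namespace Henkin

variable {T : Set Fml}

/-- Consistency with `T` of a finite list of formulas. -/
def Con (T : Set Fml) (Γ : List Fml) : Prop := ¬ Derives T Γ Fml.bot

/-- Henkin's step for numbers: a consistent list that refutes `∀ x B` stays consistent with a
counterexample, namely a number variable that does not occur yet. -/
theorem exists_number_witness {Γ : List Fml} {B : Fml} (h : Con T Γ) (hB : (¬ₒ(Fml.allN B)) ∈ Γ) :
    ∃ t, Con T ((¬ₒ(B.instN t)) :: Γ) := by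
  obtain ⟨k, hk⟩ := Derives.exists_fresh_number (T := T) Γ B
  exact ⟨v k, fun hd => h (.impE (.hyp hB) (hk (.raa hd)))⟩

/-- Henkin's step for sets. -/
theorem exists_set_witness {Γ : List Fml} {B : Fml} (h : Con T Γ) (hB : (¬ₒ(Fml.allS B)) ∈ Γ) :
    ∃ Y, Con T ((¬ₒ(B.instS Y)) :: Γ) := by
  obtain ⟨k, hk⟩ := Derives.exists_fresh_set (T := T) Γ B
  exact ⟨k, fun hd => h (.impE (.hyp hB) (hk (.raa hd)))⟩

/-- One step in the construction of a complete theory: if `A` is consistent with `Γ`, it is added,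
with a counterexample if it is a negated universal formula. -/
theorem exists_extension (Γ : List Fml) (h : Con T Γ) (A : Fml) :
    ∃ Δ, Γ ⊆ Δ ∧ Con T Δ ∧ (Con T (A :: Γ) → A ∈ Δ ∧
      (∀ B, A = ¬ₒ(Fml.allN B) → ∃ t, (¬ₒ(B.instN t)) ∈ Δ) ∧
      (∀ B, A = ¬ₒ(Fml.allS B) → ∃ Y, (¬ₒ(B.instS Y)) ∈ Δ)) := by
  by_cases hA : Con T (A :: Γ)
  · by_cases h1 : ∃ B, A = ¬ₒ(Fml.allN B)
    · obtain ⟨B, rfl⟩ := h1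
      obtain ⟨t, ht⟩ := exists_number_witness hA List.mem_cons_self
      refine ⟨_, ?_, ht, fun _ => ⟨by simp, ?_, ?_⟩⟩
      · exact fun _ h => List.mem_cons_of_mem _ (List.mem_cons_of_mem _ h)
      · intro B' hB
        simp only [Fml.neg, Fml.imp.injEq, Fml.allN.injEq, and_true] at hB
        exact ⟨t, by simp [hB]⟩
      · intro B' hB
        simp [Fml.neg] at hB
    · by_cases h2 : ∃ B, A = ¬ₒ(Fml.allS B)
      · obtain ⟨B, rfl⟩ := h2
        obtain ⟨Y, hY⟩ := exists_set_witness hA List.mem_cons_self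
        refine ⟨_, ?_, hY, fun _ => ⟨by simp, ?_, ?_⟩⟩
        · exact fun _ h => List.mem_cons_of_mem _ (List.mem_cons_of_mem _ h)
        · intro B' hB
          simp [Fml.neg] at hB
        · intro B' hB
          simp only [Fml.neg, Fml.imp.injEq, Fml.allS.injEq, and_true] at hB
          exact ⟨Y, by simp [hB]⟩
      · exact ⟨_, List.subset_cons_self _ _, hA, fun _ => ⟨by simp,
          fun B hB => (h1 ⟨B, hB⟩).elim, fun B hB => (h2 ⟨B, hB⟩).elim⟩⟩
  · exact ⟨Γ, List.Subset.refl _, h, fun h' => (hA h').elim⟩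

/-- A deductively closed, complete and consistent set of formulas containing `T`, with witnesses
for both sorts. -/
structure Theory (T : Set Fml) where
  /-- Membership in the theory. -/
  Th : Fml → Prop
  of_ax : ∀ A ∈ T, ∀ (σ : ℕ → Tm) (ρ : ℕ → ℕ), Th (A.subst σ ρ)
  consistent : ¬ Th Fml.bot
  imp_iff : ∀ A B : Fml, Th (A →ₒ B) ↔ (Th A → Th B)
  allN_iff : ∀ A : Fml, Th (Fml.allN A) ↔ ∀ t, Th (A.instN t)
  allS_iff : ∀ A : Fml, Th (Fml.allS A) ↔ ∀ Y, Th (A.instS Y)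
  eqRefl : ∀ t : Tm, Th (t =ₒ t)
  eqSubst : ∀ (s t : Tm) (A : Fml), Th (s =ₒ t) → Th (A.instN s) → Th (A.instN t)

/-- Henkin's extension: every consistent finite list is contained in a complete consistent
theory with witnesses. -/
theorem exists_theory {Γ : List Fml} (h : Con T Γ) : ∃ H : Theory T, ∀ A ∈ Γ, H.Th A := by
  classical
  have : Nonempty Fml := ⟨Fml.bot⟩
  obtain ⟨enum, henum⟩ := exists_surjective_nat Fml
  choose f hsub hcon hwit using fun Δ : {Δ // Con T Δ} => exists_extension Δ.1 Δ.2
  let seq : ℕ → {Δ // Con T Δ} :=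
    fun n => Nat.rec ⟨Γ, h⟩ (fun n Δ => ⟨f Δ (enum n), hcon Δ (enum n)⟩) n
  have hstep : ∀ n, (seq n).1 ⊆ (seq (n + 1)).1 := fun n => hsub (seq n) (enum n)
  have hmono : ∀ m n, m ≤ n → (seq m).1 ⊆ (seq n).1 := by
    intro m n hmn
    induction hmn with
    | refl => exact List.Subset.refl _
    | step _ ih => exact fun _ h => hstep _ (ih h)
  let Th : Fml → Prop := fun A => ∃ n, Derives T (seq n).1 A
  have mp : ∀ A B, Th (A →ₒ B) → Th A → Th B := by
    rintro A B ⟨m, hm⟩ ⟨n, hn⟩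
    exact ⟨max m n, .impE (hm.weaken (hmono _ _ (le_max_left _ _)))
      (hn.weaken (hmono _ _ (le_max_right _ _)))⟩
  have cons : ¬ Th Fml.bot := fun ⟨n, hn⟩ => (seq n).2 hn
  -- Every formula is added, with a witness, when its turn comes, or else it is refuted.
  have dich : ∀ A, (∃ n, A ∈ (seq n).1 ∧
      (∀ B, A = ¬ₒ(Fml.allN B) → ∃ t, (¬ₒ(B.instN t)) ∈ (seq n).1) ∧
      (∀ B, A = ¬ₒ(Fml.allS B) → ∃ Y, (¬ₒ(B.instS Y)) ∈ (seq n).1)) ∨ Th (¬ₒA) := by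
    intro A
    obtain ⟨n, rfl⟩ := henum A
    by_cases hc : Con T (enum n :: (seq n).1)
    · exact Or.inl ⟨n + 1, hwit (seq n) (enum n) hc⟩
    · exact Or.inr ⟨n, Derives.not_of_bot (not_not.1 hc)⟩
  have hneg : ∀ A, ¬ Th A → Th (¬ₒA) := fun A hA =>
    (dich A).resolve_left fun ⟨n, hn, _⟩ => hA ⟨n, .hyp hn⟩
  have hnn : ∀ A, Th (¬ₒ(¬ₒA)) → Th A := by
    intro A hA
    by_contra h
    exact cons (mp _ _ hA (hneg A h))
  refine ⟨⟨Th, fun A hA σ ρ => ⟨0, Derives.subst_of_forall (fun _ => .ax hA) _ _ _⟩, cons,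
    fun A B => ⟨mp A B, fun hAB => ?_⟩, fun A => ⟨fun ⟨n, hn⟩ t => ⟨n, .allNE t hn⟩, fun hA => ?_⟩,
    fun A => ⟨fun ⟨n, hn⟩ t => ⟨n, .allSE t hn⟩, fun hA => ?_⟩, fun t => ⟨0, .eqRefl t⟩, ?_⟩,
    fun A hA => ⟨0, .hyp hA⟩⟩
  · by_cases hA : Th A
    · obtain ⟨n, hn⟩ := hAB hA
      exact ⟨n, .impI (hn.weaken (List.subset_cons_self _ _))⟩
    · obtain ⟨n, hn⟩ := hneg A hA
      exact ⟨n, .impI (Derives.exfalso (.impE (hn.weaken (List.subset_cons_self _ _))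
        (.hyp List.mem_cons_self)))⟩
  · rcases dich (¬ₒ(Fml.allN A)) with ⟨n, -, hw, -⟩ | h
    · obtain ⟨t, ht⟩ := hw A rfl
      exact (cons (mp _ _ ⟨n, .hyp ht⟩ (hA t))).elim
    · exact hnn _ h
  · rcases dich (¬ₒ(Fml.allS A)) with ⟨n, -, -, hw⟩ | h
    · obtain ⟨t, ht⟩ := hw A rfl
      exact (cons (mp _ _ ⟨n, .hyp ht⟩ (hA t))).elim
    · exact hnn _ h
  · rintro s t A ⟨m, hm⟩ ⟨n, hn⟩
    exact ⟨max m n, .eqSubst A (hm.weaken (hmono _ _ (le_max_left _ _)))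
      (hn.weaken (hmono _ _ (le_max_right _ _)))⟩

namespace Theory

variable (H : Theory T)

theorem eqSymm {s t : Tm} (h : H.Th (s =ₒ t)) : H.Th (t =ₒ s) := by
  have h' := H.eqSubst s t (v 0 =ₒ s.lift 1) h
  simp only [Fml.instN_eq, Fml.subst, Tm.lift_subst_scons, Tm.subst_v] at h'
  exact h' (H.eqRefl s)

theorem eqTrans {s t u : Tm} (h : H.Th (s =ₒ t)) (h' : H.Th (t =ₒ u)) : H.Th (s =ₒ u) := by
  have h2 := H.eqSubst t u (s.lift 1 =ₒ v 0) h'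
  simp only [Fml.instN_eq, Fml.subst, Tm.lift_subst_scons, Tm.subst_v] at h2
  exact h2 h

/-- Provably equal terms. -/
def setoid : Setoid Tm where
  r s t := H.Th (s =ₒ t)
  iseqv := ⟨H.eqRefl, H.eqSymm, H.eqTrans⟩

/-- Provable equality is respected by an operation on terms that commutes with substitution. -/
theorem congr_op (op : Tm → Tm → Tm)
    (hop : ∀ a b σ, (op a b).subst σ = op (a.subst σ) (b.subst σ))
    {s s' t t' : Tm} (hs : H.Th (s =ₒ s')) (ht : H.Th (t =ₒ t')) :
    H.Th (op s t =ₒ op s' t') := by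
  have h1 := H.eqSubst s s' ((op s t).lift 1 =ₒ op (v 0) (t.lift 1)) hs
  have h2 := H.eqSubst t t' ((op s t).lift 1 =ₒ op (s'.lift 1) (v 0)) ht
  simp only [Fml.instN_eq, Fml.subst, Tm.lift_subst_scons, Tm.subst_v, hop, Tm.subst,
    scons_zero] at h1 h2
  exact h2 (h1 (H.eqRefl _))

theorem congr_lt {s s' t t' : Tm} (hs : H.Th (s =ₒ s')) (ht : H.Th (t =ₒ t'))
    (h : H.Th (s <ₒ t)) : H.Th (s' <ₒ t') := by
  have h1 := H.eqSubst s s' (v 0 <ₒ t.lift 1) hs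
  have h2 := H.eqSubst t t' (s'.lift 1 <ₒ v 0) ht
  simp only [Fml.instN_eq, Fml.subst, Tm.lift_subst_scons, Tm.subst_v, Tm.subst,
    scons_zero] at h1 h2
  exact h2 (h1 h)

theorem congr_mem {s s' : Tm} {X : ℕ} (hs : H.Th (s =ₒ s')) (h : H.Th (s ∈ₒ X)) :
    H.Th (s' ∈ₒ X) := by
  have h1 := H.eqSubst s s' (v 0 ∈ₒ X) hs
  simp only [Fml.instN_eq, Fml.subst, Tm.subst, scons_zero, id] at h1
  exact h1 h

/-- The numbers of the term model. -/
def Num : Type := Quotient H.setoid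

/-- The value of a term in the term model. -/
def num (t : Tm) : H.Num := Quotient.mk H.setoid t

theorem num_eq {s t : Tm} : H.num s = H.num t ↔ H.Th (s =ₒ t) := Quotient.eq (r := H.setoid)

theorem num_surjective (x : H.Num) : ∃ t, H.num t = x := Quotient.exists_rep x

instance : Countable H.Num := Quotient.countable
instance : Zero H.Num := ⟨H.num Tm.zero⟩
instance : One H.Num := ⟨H.num Tm.one⟩
instance : Add H.Num := ⟨Quotient.map₂ Tm.add fun _ _ hs _ _ ht =>
  H.congr_op Tm.add (fun _ _ _ => rfl) hs ht⟩
instance : Mul H.Num := ⟨Quotient.map₂ Tm.mul fun _ _ hs _ _ ht =>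
  H.congr_op Tm.mul (fun _ _ _ => rfl) hs ht⟩
instance : LT H.Num := ⟨Quotient.lift₂ (fun s t => H.Th (s <ₒ t)) fun _ _ _ _ hs ht =>
  propext ⟨H.congr_lt hs ht, H.congr_lt (H.eqSymm hs) (H.eqSymm ht)⟩⟩

/-- The interpretation of set variables in the term model. -/
def setOf (X : ℕ) : Set H.Num :=
  {x | Quotient.lift (fun t => H.Th (t ∈ₒ X)) (fun _ _ hs =>
    propext ⟨H.congr_mem hs, H.congr_mem (H.eqSymm hs)⟩) x}

theorem eval_num (σ : ℕ → Tm) (t : Tm) : t.eval (fun i => H.num (σ i)) = H.num (t.subst σ) := by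
  induction t with
  | var i => rfl
  | zero => rfl
  | one => rfl
  | add s t hs ht =>
    rw [Tm.eval, hs, ht]
    rfl
  | mul s t hs ht =>
    rw [Tm.eval, hs, ht]
    rfl

/-- Truth in the term model is membership in the theory. -/
theorem sat_iff (A : Fml) (σ : ℕ → Tm) (ρ : ℕ → ℕ) :
    Sat (Set.range H.setOf) A (fun i => H.num (σ i)) (fun i => H.setOf (ρ i)) ↔
      H.Th (A.subst σ ρ) := by
  induction A generalizing σ ρ with
  | eq s t => rw [Sat, eval_num, eval_num, num_eq, Fml.subst]
  | lt s t =>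
    rw [Sat, eval_num, eval_num]
    rfl
  | mem t X =>
    rw [Sat, eval_num]
    rfl
  | bot => exact ⟨False.elim, H.consistent⟩
  | imp A B hA hB => rw [Sat, Fml.subst, H.imp_iff, hA, hB]
  | allN A hA =>
    rw [Sat, Fml.subst_allN, H.allN_iff]
    have key : ∀ t, Sat (Set.range H.setOf) A (scons (H.num t) fun i => H.num (σ i))
        (fun i => H.setOf (ρ i)) ↔ H.Th ((A.subst (up σ) ρ).instN t) := by
      intro t
      rw [Fml.subst_up_instN, ← hA]
      refine iff_of_eq (congrArg (fun e => Sat _ A e _) ?_)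
      exact (eq_scons (f := fun i => H.num (scons t σ i)) rfl fun _ => rfl).symm
    refine ⟨fun h t => (key t).1 (h _), fun h x => ?_⟩
    obtain ⟨t, rfl⟩ := H.num_surjective x
    exact (key t).2 (h t)
  | allS A hA =>
    rw [Sat, Fml.subst_allS, H.allS_iff]
    have key : ∀ Y, Sat (Set.range H.setOf) A (fun i => H.num (σ i))
        (scons (H.setOf Y) fun i => H.setOf (ρ i)) ↔ H.Th ((A.subst σ (upS ρ)).instS Y) := by
      intro Y
      rw [Fml.subst_upS_instS, ← hA]
      refine iff_of_eq (congrArg (Sat _ A _) ?_)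
      exact (eq_scons (f := fun i => H.setOf (scons Y ρ i)) rfl fun _ => rfl).symm
    refine ⟨fun h Y => (key Y).1 (h _ ⟨Y, rfl⟩), ?_⟩
    rintro h _ ⟨Y, rfl⟩
    exact (key Y).2 (h Y)

end Theory

end Henkin

/-- Completeness: a formula true in all countable general models of `T` is provable from `T`. -/
theorem proves_of_sat {T : Set Fml} {A : Fml}
    (h : ∀ (M : Type) [Countable M] [Zero M] [One M] [Add M] [Mul M] [LT M] (S : Set (Set M)),
      S.Countable → S.Nonempty → (∀ B ∈ T, ∀ e s, (∀ i, s i ∈ S) → Sat S B e s) →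
      ∀ e s, (∀ i, s i ∈ S) → Sat S A e s) : Proves T A := by
  by_contra hA
  obtain ⟨H, hH⟩ := Henkin.exists_theory (T := T) (Γ := [¬ₒA]) fun hd => hA (.raa hd)
  have hmodel : ∀ B ∈ T, ∀ e s, (∀ i, s i ∈ Set.range H.setOf) → Sat (Set.range H.setOf) B e s := by
    intro B hB e s hs
    choose σ hσ using fun i => H.num_surjective (e i)
    choose ρ hρ using hs
    obtain rfl : (fun i => H.num (σ i)) = e := funext hσ
    obtain rfl : (fun i => H.setOf (ρ i)) = s := funext hρ
    exact (H.sat_iff B σ ρ).2 (H.of_ax B hB σ ρ)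
  have h1 := h H.Num _ (Set.countable_range H.setOf) (Set.range_nonempty _) hmodel
    (fun i => H.num (v i)) (fun i => H.setOf (id i)) fun i => ⟨i, rfl⟩
  rw [H.sat_iff, Fml.subst_id] at h1
  have h2 := hH _ List.mem_cons_self
  exact H.consistent ((H.imp_iff _ _).1 h2 h1)

/-! ### Evaluation of formulas -/

section Evaluation

variable {M : Type} [Zero M] [One M] [Add M] [Mul M]

@[simp] theorem Tm.eval_v (e : ℕ → M) (i : ℕ) : (v i).eval e = e i := rfl
@[simp] theorem Tm.eval_zero (e : ℕ → M) : (0 : Tm).eval e = 0 := rfl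
@[simp] theorem Tm.eval_one (e : ℕ → M) : (1 : Tm).eval e = 1 := rfl
@[simp] theorem Tm.eval_add (e : ℕ → M) (s t : Tm) :
    (s + t).eval e = s.eval e + t.eval e := rfl
@[simp] theorem Tm.eval_mul (e : ℕ → M) (s t : Tm) :
    (s * t).eval e = s.eval e * t.eval e := rfl

theorem Tm.eval_subst (e : ℕ → M) (σ : ℕ → Tm) (t : Tm) :
    (t.subst σ).eval e = t.eval fun i => (σ i).eval e := by
  induction t with
  | var i => rfl
  | zero => rfl
  | one => rfl
  | add s t hs ht => simp only [Tm.subst, Tm.eval, hs, ht]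
  | mul s t hs ht => simp only [Tm.subst, Tm.eval, hs, ht]

@[simp] theorem Tm.eval_lift (e : ℕ → M) (k : ℕ) (t : Tm) :
    (t.lift k).eval e = t.eval fun i => e (i + k) := Tm.eval_subst _ _ _

theorem Tm.eval_up (σ : ℕ → Tm) (e : ℕ → M) (x : M) :
    (fun i => (up σ i).eval (scons x e)) = scons x fun i => (σ i).eval e :=
  eq_scons rfl fun _ => (Tm.eval_lift _ _ _).trans rfl

variable [LT M] {S : Set (Set M)}

theorem sat_subst (A : Fml) (σ : ℕ → Tm) (ρ : ℕ → ℕ) (e : ℕ → M) (s : ℕ → Set M) :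
    Sat S (A.subst σ ρ) e s ↔ Sat S A (fun i => (σ i).eval e) fun i => s (ρ i) := by
  induction A generalizing σ ρ e s with
  | eq a b => simp only [Fml.subst, Sat, Tm.eval_subst]
  | lt a b => simp only [Fml.subst, Sat, Tm.eval_subst]
  | mem t X => simp only [Fml.subst, Sat, Tm.eval_subst]
  | bot => exact Iff.rfl
  | imp A B hA hB => simp only [Fml.subst, Sat, hA, hB]
  | allN A hA =>
    rw [Fml.subst_allN, Sat, Sat]
    refine forall_congr' fun x => ?_
    rw [hA, Tm.eval_up]
  | allS A hA =>
    rw [Fml.subst_allS, Sat, Sat]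
    refine forall₂_congr fun X _ => ?_
    rw [hA, eq_scons (f := fun i => scons X s (upS ρ i)) rfl fun _ => rfl]
    rfl

variable (e : ℕ → M) (s : ℕ → Set M) (A B : Fml)

@[simp] theorem sat_eq (a b : Tm) : Sat S (a =ₒ b) e s ↔ a.eval e = b.eval e := Iff.rfl
@[simp] theorem sat_lt (a b : Tm) : Sat S (a <ₒ b) e s ↔ a.eval e < b.eval e := Iff.rfl
@[simp] theorem sat_mem (t : Tm) (X : ℕ) : Sat S (t ∈ₒ X) e s ↔ t.eval e ∈ s X := Iff.rfl
@[simp] theorem sat_bot : Sat S Fml.bot e s ↔ False := Iff.rfl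
@[simp] theorem sat_imp : Sat S (A →ₒ B) e s ↔ (Sat S A e s → Sat S B e s) := Iff.rfl
@[simp] theorem sat_neg : Sat S (¬ₒA) e s ↔ ¬ Sat S A e s := Iff.rfl
@[simp] theorem sat_top : Sat S Fml.top e s ↔ True := by simp [Fml.top]
@[simp] theorem sat_conj : Sat S (A ∧ₒ B) e s ↔ Sat S A e s ∧ Sat S B e s := by
  simp [Fml.conj]
@[simp] theorem sat_disj : Sat S (A ∨ₒ B) e s ↔ Sat S A e s ∨ Sat S B e s := by
  simp only [Fml.disj, sat_imp, sat_neg]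
  tauto
@[simp] theorem sat_iff : Sat S (A ↔ₒ B) e s ↔ (Sat S A e s ↔ Sat S B e s) := by
  simp only [Fml.iff, sat_conj, sat_imp]
  tauto
@[simp] theorem sat_allN : Sat S (Fml.allN A) e s ↔ ∀ x, Sat S A (scons x e) s := Iff.rfl
@[simp] theorem sat_allS : Sat S (Fml.allS A) e s ↔ ∀ X ∈ S, Sat S A e (scons X s) := Iff.rfl
@[simp] theorem sat_exN : Sat S (Fml.exN A) e s ↔ ∃ x, Sat S A (scons x e) s := by
  simp [Fml.exN]
@[simp] theorem sat_exS : Sat S (Fml.exS A) e s ↔ ∃ X ∈ S, Sat S A e (scons X s) := by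
  simp [Fml.exS]
@[simp] theorem sat_ballN (t : Tm) :
    Sat S (ballN t A) e s ↔ ∀ x, x < t.eval e → Sat S A (scons x e) s := by
  simp [ballN]
@[simp] theorem sat_bexN (t : Tm) :
    Sat S (bexN t A) e s ↔ ∃ x, x < t.eval e ∧ Sat S A (scons x e) s := by
  simp [bexN]
@[simp] theorem sat_instN (t : Tm) :
    Sat S (A.instN t) e s ↔ Sat S A (scons (t.eval e) e) s := by
  rw [Fml.instN_eq, sat_subst, eq_scons (f := fun i => (scons t v i).eval e) rfl fun _ => rfl]
  rfl
@[simp] theorem sat_app (k : ℕ) (t : Tm) :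
    Sat S (A.app k t) e s ↔ Sat S A (scons (t.eval e) fun i => e (i + k)) s := by
  rw [Fml.app_eq, sat_subst,
    eq_scons (f := fun i => (scons t (fun i => v (i + k)) i).eval e) rfl fun _ => rfl]
  rfl
@[simp] theorem sat_liftS (X : Set M) : Sat S A.liftS e (scons X s) ↔ Sat S A e s := by
  rw [Fml.liftS, sat_subst]
  rfl

end Evaluation

theorem Sigma00.subst {A : Fml} (h : Sigma00 A) (σ : ℕ → Tm) (ρ : ℕ → ℕ) :
    Sigma00 (A.subst σ ρ) := by
  induction h generalizing σ ρ with
  | eq s t => exact .eq _ _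
  | lt s t => exact .lt _ _
  | mem t X => exact .mem _ _
  | bot => exact .bot
  | imp _ _ hA hB => exact .imp (hA σ ρ) (hB σ ρ)
  | @ball t A _ hA =>
    have h : (ballN t A).subst σ ρ = ballN (t.subst σ) (A.subst (up σ) ρ) := by
      rw [ballN, Fml.subst_allN, ballN]
      simp only [Fml.subst]
      rw [Tm.subst_lift, up, Tm.lift_subst_scons]
      rfl
    rw [h]
    exact .ball _ (hA _ ρ)

/-! ### Countable models of `RCA₀` and definability in them -/

/-- A general model of `RCA₀` in which all numbers and all sets are listed. -/
structure Model (M : Type) [Zero M] [One M] [Add M] [Mul M] [LT M] where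
  /-- The sets of the model. -/
  S : Set (Set M)
  /-- A list of all numbers. -/
  num : ℕ → M
  num_surj : Function.Surjective num
  /-- A list of all sets. -/
  set : ℕ → Set M
  set_mem : ∀ i, set i ∈ S
  set_surj : ∀ X ∈ S, ∃ i, set i = X
  rca : ∀ A ∈ RCA0, ∀ e s, (∀ i, s i ∈ S) → Sat S A e s

/-- The sequence `e 0, p 0, e 1, p 1, …`. -/
def mix {α : Type*} (e p : ℕ → α) (n : ℕ) : α := if n % 2 = 0 then e (n / 2) else p (n / 2)

@[simp] theorem mix_even {α : Type*} (e p : ℕ → α) (n : ℕ) : mix e p (2 * n) = e n := by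
  simp [mix]

@[simp] theorem mix_odd {α : Type*} (e p : ℕ → α) (n : ℕ) : mix e p (2 * n + 1) = p n := by
  simp [mix, show (2 * n + 1) / 2 = n by omega]

theorem apply_mix {α β : Type*} (g : α → β) (e p : ℕ → α) (n : ℕ) :
    g (mix e p n) = mix (fun i => g (e i)) (fun i => g (p i)) n := by
  unfold mix
  split_ifs <;> rfl

namespace Model

variable {M : Type} [Zero M] [One M] [Add M] [Mul M] [LT M] (𝓜 : Model M)

/-- A function of the variables `e` that is the value of a term with parameters. -/
def IsTerm (t : (ℕ → M) → M) : Prop := ∃ τ : Tm, ∀ e, t e = τ.eval (mix e 𝓜.num)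

/-- A condition on number variables `e` and one set variable `X` that is defined by a bounded
formula with number and set parameters. All numbers and sets of the model are listed, so they
all are available as parameters: the numbers are the values of the odd variables, the sets those of
the set variables `1, 2, …`. -/
def Bounded (P : (ℕ → M) → Set M → Prop) : Prop :=
  ∃ A, Sigma00 A ∧ ∀ e X, P e X ↔ Sat 𝓜.S A (mix e 𝓜.num) (scons X 𝓜.set)

variable {𝓜}

theorem IsTerm.var (i : ℕ) : 𝓜.IsTerm fun e => e i := ⟨v (2 * i), fun e => by simp⟩

theorem IsTerm.const (c : M) : 𝓜.IsTerm fun _ => c := by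
  obtain ⟨i, rfl⟩ := 𝓜.num_surj c
  exact ⟨v (2 * i + 1), fun e => by simp⟩

theorem IsTerm.add {t u : (ℕ → M) → M} (ht : 𝓜.IsTerm t) (hu : 𝓜.IsTerm u) :
    𝓜.IsTerm fun e => t e + u e := by
  obtain ⟨τ, hτ⟩ := ht
  obtain ⟨υ, hυ⟩ := hu
  exact ⟨τ + υ, fun e => by simp [hτ, hυ]⟩

theorem IsTerm.mul {t u : (ℕ → M) → M} (ht : 𝓜.IsTerm t) (hu : 𝓜.IsTerm u) :
    𝓜.IsTerm fun e => t e * u e := by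
  obtain ⟨τ, hτ⟩ := ht
  obtain ⟨υ, hυ⟩ := hu
  exact ⟨τ * υ, fun e => by simp [hτ, hυ]⟩

namespace Bounded

variable {P Q : (ℕ → M) → Set M → Prop} {t u w : (ℕ → M) → M}

theorem congr (h : 𝓜.Bounded P) (hPQ : ∀ e X, Q e X ↔ P e X) : 𝓜.Bounded Q := by
  obtain ⟨A, hA, hs⟩ := h
  exact ⟨A, hA, fun e X => (hPQ e X).trans (hs e X)⟩

theorem eq (ht : 𝓜.IsTerm t) (hu : 𝓜.IsTerm u) : 𝓜.Bounded fun e _ => t e = u e := by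
  obtain ⟨τ, hτ⟩ := ht
  obtain ⟨υ, hυ⟩ := hu
  exact ⟨τ =ₒ υ, .eq _ _, fun e X => by simp [hτ, hυ]⟩

theorem lt (ht : 𝓜.IsTerm t) (hu : 𝓜.IsTerm u) : 𝓜.Bounded fun e _ => t e < u e := by
  obtain ⟨τ, hτ⟩ := ht
  obtain ⟨υ, hυ⟩ := hu
  exact ⟨τ <ₒ υ, .lt _ _, fun e X => by simp [hτ, hυ]⟩

theorem memVar (ht : 𝓜.IsTerm t) : 𝓜.Bounded fun e X => t e ∈ X := by
  obtain ⟨τ, hτ⟩ := ht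
  exact ⟨τ ∈ₒ 0, .mem _ _, fun e X => by simp [hτ]⟩

theorem mem {Y : Set M} (hY : Y ∈ 𝓜.S) (ht : 𝓜.IsTerm t) : 𝓜.Bounded fun e _ => t e ∈ Y := by
  obtain ⟨τ, hτ⟩ := ht
  obtain ⟨i, rfl⟩ := 𝓜.set_surj Y hY
  exact ⟨τ ∈ₒ (i + 1), .mem _ _, fun e X => by simp [hτ]⟩

theorem imp (hP : 𝓜.Bounded P) (hQ : 𝓜.Bounded Q) : 𝓜.Bounded fun e X => P e X → Q e X := by
  obtain ⟨A, hA, hAs⟩ := hP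
  obtain ⟨B, hB, hBs⟩ := hQ
  exact ⟨A →ₒ B, .imp hA hB, fun e X => by simp [hAs, hBs]⟩

theorem false : 𝓜.Bounded fun _ _ => False := ⟨Fml.bot, .bot, fun e X => by simp⟩

theorem not (hP : 𝓜.Bounded P) : 𝓜.Bounded fun e X => ¬ P e X := imp hP false

theorem and (hP : 𝓜.Bounded P) (hQ : 𝓜.Bounded Q) : 𝓜.Bounded fun e X => P e X ∧ Q e X :=
  (hP.imp hQ.not).not.congr fun _ _ => by tauto

theorem or (hP : 𝓜.Bounded P) (hQ : 𝓜.Bounded Q) : 𝓜.Bounded fun e X => P e X ∨ Q e X :=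
  (hP.not.imp hQ).congr fun _ _ => by tauto

theorem iff (hP : 𝓜.Bounded P) (hQ : 𝓜.Bounded Q) : 𝓜.Bounded fun e X => P e X ↔ Q e X :=
  ((hP.imp hQ).and (hQ.imp hP)).congr fun _ _ => by tauto

/-- Bounded universal quantification; the bound variable becomes variable `0`. -/
theorem ball {R : M → (ℕ → M) → Set M → Prop} (ht : 𝓜.IsTerm t)
    (hR : 𝓜.Bounded fun e X => R (e 0) (fun i => e (i + 1)) X) :
    𝓜.Bounded fun e X => ∀ x, x < t e → R x e X := by
  obtain ⟨τ, hτ⟩ := ht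
  obtain ⟨A, hA, hs⟩ := hR
  -- Under the quantifier the environment is `x, e 0, p 0, e 1, p 1, …`; the formula `A` expects
  -- `x, p 0, e 0, p 1, …`.
  refine ⟨ballN τ (A.subst (mix (fun i => scons (v 0) (fun i => v (2 * i + 1)) i)
    fun i => v (2 * i + 2)) id), .ball _ (hA.subst _ _), fun e X => ?_⟩
  rw [sat_ballN]
  simp only [hτ]
  refine forall₂_congr fun x _ => ?_
  rw [sat_subst]
  refine (hs (scons x e) X).trans (iff_of_eq ?_)
  congr 1
  funext n
  rw [apply_mix (fun t : Tm => t.eval (scons x (mix e 𝓜.num)))]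
  congr 1
  · funext i
    cases i with
    | zero => rfl
    | succ i => simp
  · funext i
    exact (mix_odd e 𝓜.num i).symm

theorem bex {R : M → (ℕ → M) → Set M → Prop} (ht : 𝓜.IsTerm t)
    (hR : 𝓜.Bounded fun e X => R (e 0) (fun i => e (i + 1)) X) :
    𝓜.Bounded fun e X => ∃ x, x < t e ∧ R x e X :=
  (ball (R := fun x e X => ¬ R x e X) ht hR.not).not.congr fun _ _ => by
    simp only [not_forall, not_not, exists_prop]

/-- Bounded conditions are closed under substitution of terms. -/
theorem comp (hP : 𝓜.Bounded P) {σ : ℕ → (ℕ → M) → M} (hσ : ∀ i, 𝓜.IsTerm (σ i)) :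
    𝓜.Bounded fun e X => P (fun i => σ i e) X := by
  obtain ⟨A, hA, hs⟩ := hP
  choose τ hτ using hσ
  refine ⟨A.subst (mix τ fun i => v (2 * i + 1)) id, hA.subst _ _, fun e X => ?_⟩
  refine (hs _ X).trans ?_
  rw [sat_subst]
  refine iff_of_eq ?_
  congr 1
  funext n
  rw [apply_mix (fun t : Tm => t.eval (mix e 𝓜.num))]
  simp [hτ]

theorem comp₁ {R : M → Prop} (hR : 𝓜.Bounded fun e _ => R (e 0)) (ht : 𝓜.IsTerm t) :
    𝓜.Bounded fun e _ => R (t e) :=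
  hR.comp (σ := fun _ => t) fun _ => ht

theorem comp₂ {R : M → M → Prop} (hR : 𝓜.Bounded fun e _ => R (e 0) (e 1)) (ht : 𝓜.IsTerm t)
    (hu : 𝓜.IsTerm u) : 𝓜.Bounded fun e _ => R (t e) (u e) :=
  hR.comp (σ := scons t fun _ => u) fun i => by cases i <;> assumption

theorem comp₃ {R : M → M → M → Prop} (hR : 𝓜.Bounded fun e _ => R (e 0) (e 1) (e 2))
    (ht : 𝓜.IsTerm t) (hu : 𝓜.IsTerm u) (hw : 𝓜.IsTerm w) :
    𝓜.Bounded fun e _ => R (t e) (u e) (w e) :=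
  hR.comp (σ := scons t (scons u fun _ => w)) fun i => by
    rcases i with _ | _ | i <;> assumption

/-- A defining formula in which the two number variables are the first ones and the parameters
follow. -/
theorem exists_formula {R : M → M → Set M → Prop} (hR : 𝓜.Bounded fun e X => R (e 0) (e 1) X) :
    ∃ A, Sigma00 A ∧ ∀ x y X,
      R x y X ↔ Sat 𝓜.S A (scons x (scons y 𝓜.num)) (scons X 𝓜.set) := by
  obtain ⟨A, hA, hs⟩ := hR
  refine ⟨A.subst (mix (scons (v 0) fun _ => v 1) fun i => v (i + 2)) id, hA.subst _ _,
    fun x y X => ?_⟩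
  rw [sat_subst]
  refine (hs (scons x fun _ => y) X).trans (iff_of_eq ?_)
  congr 1
  funext n
  rw [apply_mix (fun t : Tm => t.eval (scons x (scons y 𝓜.num)))]
  congr 1
  funext i
  cases i <;> rfl

end Bounded

/-- `Σ⁰₁` induction. -/
theorem induction_exists {R : M → M → Prop} (hR : 𝓜.Bounded fun e _ => R (e 0) (e 1))
    (h0 : ∃ y, R 0 y) (hs : ∀ x, (∃ y, R x y) → ∃ y, R (x + 1) y) (x : M) : ∃ y, R x y := by
  have hR' : 𝓜.Bounded fun e _ => R (e 1) (e 0) := hR.comp₂ (.var 1) (.var 0)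
  obtain ⟨A, hA, hAs⟩ := hR'.exists_formula (R := fun x y _ => R y x)
  have h := 𝓜.rca _ (RCA0Axiom.induction ⟨A, hA, rfl⟩) 𝓜.num (scons (𝓜.set 0) 𝓜.set)
    fun i => by cases i <;> exact 𝓜.set_mem _
  simp only [inductionFor, sat_imp, sat_conj, sat_instN, sat_allN, sat_app, sat_exN] at h
  have h := h ⟨?_, ?_⟩ x
  · obtain ⟨y, hy⟩ := h
    exact ⟨y, (hAs _ _ _).2 hy⟩
  · obtain ⟨y, hy⟩ := h0
    exact ⟨y, (hAs _ _ _).1 hy⟩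
  · rintro x ⟨y, hy⟩
    obtain ⟨z, hz⟩ := hs x ⟨y, (hAs _ _ _).2 hy⟩
    exact ⟨z, (hAs _ _ _).1 hz⟩

/-- Induction for bounded formulas. -/
theorem induction {R : M → Prop} (hR : 𝓜.Bounded fun e _ => R (e 0))
    (h0 : R 0) (hs : ∀ x, R x → R (x + 1)) (x : M) : R x :=
  (𝓜.induction_exists (R := fun x _ => R x) hR ⟨0, h0⟩
    (fun x ⟨y, hy⟩ => ⟨y, hs x hy⟩) x).elim fun _ h => h

/-- `Δ⁰₁` comprehension. -/
theorem delta_comprehension {R Q : M → M → Prop} (hR : 𝓜.Bounded fun e _ => R (e 0) (e 1))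
    (hQ : 𝓜.Bounded fun e _ => Q (e 0) (e 1)) (h : ∀ x, (∃ y, R x y) ↔ ∀ y, Q x y) :
    {x | ∃ y, R x y} ∈ 𝓜.S := by
  have hR' : 𝓜.Bounded fun e _ => R (e 1) (e 0) := hR.comp₂ (.var 1) (.var 0)
  have hQ' : 𝓜.Bounded fun e _ => Q (e 1) (e 0) := hQ.comp₂ (.var 1) (.var 0)
  obtain ⟨A, hA, hAs⟩ := hR'.exists_formula (R := fun x y _ => R y x)
  obtain ⟨B, hB, hBs⟩ := hQ'.exists_formula (R := fun x y _ => Q y x)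
  have hc := 𝓜.rca _ (RCA0Axiom.comprehension ⟨A, hA, rfl⟩ ⟨B, hB, rfl⟩) 𝓜.num
    (scons (𝓜.set 0) 𝓜.set) fun i => by cases i <;> exact 𝓜.set_mem _
  simp only [deltaComprehensionFor, sat_imp, sat_iff, sat_allN, sat_exN, sat_exS, ← hAs, ← hBs,
    sat_liftS, sat_mem] at hc
  obtain ⟨X, hX, hXs⟩ := hc h
  convert hX
  ext x
  exact (hXs x).symm

/-- Comprehension for bounded formulas. -/
theorem comprehension {R : M → Prop} (hR : 𝓜.Bounded fun e _ => R (e 0)) :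
    {x | R x} ∈ 𝓜.S := by
  convert delta_comprehension (R := fun x _ => R x) (Q := fun x _ => R x) hR hR ?_
  · exact ⟨fun h => ⟨0, h⟩, fun ⟨_, h⟩ => h⟩
  · exact fun x => ⟨fun ⟨_, h⟩ _ => h, fun h => ⟨0, h 0⟩⟩

end Model

namespace Model

section Automation

variable {M : Type} [Zero M] [One M] [Add M] [Mul M] [LT M] {𝓜 : Model M}

theorem Bounded.const (p : Prop) : 𝓜.Bounded fun _ _ => p := by
  by_cases hp : p
  · exact Bounded.false.not.congr fun _ _ => by simp [hp]
  · exact Bounded.false.congr fun _ _ => by simp [hp]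

/-- Bounded definability of conditions built from numerical terms. -/
theorem Bounded.arith {P : (ℕ → M) → Set M → Prop} (h : 𝓜.Bounded P := by
  repeat' first
    | with_reducible exact SOA.Model.IsTerm.var _
    | with_reducible exact SOA.Model.IsTerm.const _
    | with_reducible apply SOA.Model.IsTerm.add
    | with_reducible apply SOA.Model.IsTerm.mul
    | with_reducible exact SOA.Model.Bounded.const _
    | with_reducible apply SOA.Model.Bounded.eq
    | with_reducible apply SOA.Model.Bounded.lt
    | with_reducible apply SOA.Model.Bounded.not
    | with_reducible apply SOA.Model.Bounded.and
    | with_reducible apply SOA.Model.Bounded.or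
    | with_reducible apply SOA.Model.Bounded.iff
    | with_reducible apply SOA.Model.Bounded.ball
    | with_reducible apply SOA.Model.Bounded.bex
    | with_reducible apply SOA.Model.Bounded.imp) : 𝓜.Bounded P := h

end Automation

/-! ### Arithmetic from the basic axioms -/

-- The lemmas with prefix `raw` are stated for the operations of a model as they are given; they
-- serve to make the numbers an instance of `Numbers`, after which Mathlib's algebra applies.

section Arithmetic

variable {M : Type} [Zero M] [One M] [Add M] [Mul M] [LT M]

theorem sat_basic (𝓜 : Model M) {A : Fml} (hA : BasicAxiom A) (x y : M) :
    Sat 𝓜.S A (scons x (scons y 𝓜.num)) 𝓜.set :=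
  𝓜.rca _ (RCA0Axiom.basic hA) _ _ 𝓜.set_mem

theorem raw_succ_ne_zero (𝓜 : Model M) (x : M) : x + 1 ≠ 0 := 𝓜.sat_basic .succ_ne_zero x x
theorem raw_succ_inj (𝓜 : Model M) {x y : M} : x + 1 = y + 1 → x = y := 𝓜.sat_basic .succ_inj x y
theorem raw_add_zero (𝓜 : Model M) (x : M) : x + 0 = x := 𝓜.sat_basic .add_zero x x
theorem raw_add_succ (𝓜 : Model M) (x y : M) : x + (y + 1) = (x + y) + 1 := 𝓜.sat_basic .add_succ x y
theorem raw_mul_zero (𝓜 : Model M) (x : M) : x * 0 = 0 := 𝓜.sat_basic .mul_zero x x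
theorem raw_mul_succ (𝓜 : Model M) (x y : M) : x * (y + 1) = x * y + x := 𝓜.sat_basic .mul_succ x y
theorem raw_not_lt_zero (𝓜 : Model M) (x : M) : ¬ x < 0 := 𝓜.sat_basic .not_lt_zero x x
theorem raw_lt_succ (𝓜 : Model M) (x y : M) : x < y + 1 ↔ x < y ∨ x = y := by
  have h := 𝓜.sat_basic .lt_succ x y
  rw [sat_iff, sat_disj] at h
  exact h

theorem raw_zero_add (𝓜 : Model M) (x : M) : 0 + x = x :=
  𝓜.induction (R := fun x => 0 + x = x) .arith (𝓜.raw_add_zero 0)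
    (fun x hx => by rw [𝓜.raw_add_succ, hx]) x

theorem raw_succ_add (𝓜 : Model M) (x y : M) : (x + 1) + y = (x + y) + 1 :=
  𝓜.induction (R := fun y => (x + 1) + y = (x + y) + 1) .arith
    (by rw [𝓜.raw_add_zero, 𝓜.raw_add_zero])
    (fun y hy => by rw [𝓜.raw_add_succ, hy, 𝓜.raw_add_succ]) y

theorem raw_add_comm (𝓜 : Model M) (x y : M) : x + y = y + x :=
  𝓜.induction (R := fun y => x + y = y + x) .arith
    (by rw [𝓜.raw_add_zero, 𝓜.raw_zero_add])
    (fun y hy => by rw [𝓜.raw_add_succ, hy, 𝓜.raw_succ_add]) y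

theorem raw_add_assoc (𝓜 : Model M) (x y z : M) : (x + y) + z = x + (y + z) :=
  𝓜.induction (R := fun z => (x + y) + z = x + (y + z)) .arith
    (by rw [𝓜.raw_add_zero, 𝓜.raw_add_zero])
    (fun z hz => by rw [𝓜.raw_add_succ, hz, 𝓜.raw_add_succ, 𝓜.raw_add_succ]) z

theorem raw_add_right_cancel (𝓜 : Model M) {x y z : M} : x + z = y + z → x = y :=
  𝓜.induction (R := fun z => x + z = y + z → x = y) .arith
    (by rw [𝓜.raw_add_zero, 𝓜.raw_add_zero]; exact id)
    (fun z hz h => hz (𝓜.raw_succ_inj (by rwa [← 𝓜.raw_add_succ, ← 𝓜.raw_add_succ]))) z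

theorem raw_zero_mul (𝓜 : Model M) (x : M) : 0 * x = 0 :=
  𝓜.induction (R := fun x => 0 * x = 0) .arith (𝓜.raw_mul_zero 0)
    (fun x hx => by rw [𝓜.raw_mul_succ, hx, 𝓜.raw_add_zero]) x

theorem raw_add_right_comm (𝓜 : Model M) (x y z : M) : (x + y) + z = (x + z) + y := by
  rw [𝓜.raw_add_assoc, 𝓜.raw_add_comm y, 𝓜.raw_add_assoc]

theorem raw_succ_mul (𝓜 : Model M) (x y : M) : (x + 1) * y = x * y + y :=
  𝓜.induction (R := fun y => (x + 1) * y = x * y + y) .arith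
    (by rw [𝓜.raw_mul_zero, 𝓜.raw_mul_zero, 𝓜.raw_add_zero])
    (fun y hy => by
      rw [𝓜.raw_mul_succ, hy, 𝓜.raw_mul_succ, 𝓜.raw_add_succ, 𝓜.raw_add_succ,
        𝓜.raw_add_right_comm (x * y) x y]) y

theorem raw_mul_comm (𝓜 : Model M) (x y : M) : x * y = y * x :=
  𝓜.induction (R := fun y => x * y = y * x) .arith
    (by rw [𝓜.raw_mul_zero, 𝓜.raw_zero_mul])
    (fun y hy => by rw [𝓜.raw_mul_succ, hy, 𝓜.raw_succ_mul]) y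

theorem raw_mul_add (𝓜 : Model M) (x y z : M) : x * (y + z) = x * y + x * z :=
  𝓜.induction (R := fun z => x * (y + z) = x * y + x * z) .arith
    (by rw [𝓜.raw_add_zero, 𝓜.raw_mul_zero, 𝓜.raw_add_zero])
    (fun z hz => by rw [𝓜.raw_add_succ, 𝓜.raw_mul_succ, hz, 𝓜.raw_mul_succ, 𝓜.raw_add_assoc]) z

theorem raw_mul_assoc (𝓜 : Model M) (x y z : M) : (x * y) * z = x * (y * z) :=
  𝓜.induction (R := fun z => (x * y) * z = x * (y * z)) .arith
    (by rw [𝓜.raw_mul_zero, 𝓜.raw_mul_zero, 𝓜.raw_mul_zero])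
    (fun z hz => by rw [𝓜.raw_mul_succ, hz, 𝓜.raw_mul_succ, 𝓜.raw_mul_add]) z

theorem raw_zero_or_succ (𝓜 : Model M) (x : M) : x = 0 ∨ ∃ y, x = y + 1 := by
  have h := 𝓜.induction_exists (R := fun x y => x = 0 ∨ x = y + 1) .arith
    ⟨0, .inl rfl⟩ (fun x _ => ⟨x, .inr rfl⟩) x
  obtain ⟨y, hy | hy⟩ := h
  · exact .inl hy
  · exact .inr ⟨y, hy⟩

theorem raw_lt_iff (𝓜 : Model M) (x y : M) : x < y ↔ ∃ d, x + (d + 1) = y := by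
  constructor
  · intro h
    have h' := 𝓜.induction_exists (R := fun y d => x < y → x + (d + 1) = y) .arith
      ⟨0, fun h => (𝓜.raw_not_lt_zero _ h).elim⟩ ?_ y
    · obtain ⟨d, hd⟩ := h'
      exact ⟨d, hd h⟩
    · rintro y ⟨d, hd⟩
      by_cases hxy : x < y
      · exact ⟨d + 1, fun _ => by rw [𝓜.raw_add_succ, hd hxy]⟩
      · refine ⟨0, fun h => ?_⟩
        rw [((𝓜.raw_lt_succ _ _).1 h).resolve_left hxy, 𝓜.raw_zero_add]
  · rintro ⟨d, rfl⟩
    refine 𝓜.induction (R := fun d => x < x + (d + 1)) .arith ?_ (fun d hd => ?_) d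
    · rw [𝓜.raw_zero_add]
      exact (𝓜.raw_lt_succ _ _).2 (.inr rfl)
    · rw [𝓜.raw_add_succ]
      exact (𝓜.raw_lt_succ _ _).2 (.inl hd)

theorem raw_total (𝓜 : Model M) (x y : M) : (∃ d, x + d = y) ∨ ∃ d, y + d = x := by
  have h := 𝓜.induction_exists (R := fun y d => x + d = y ∨ y + d = x) .arith
    ⟨x, .inr (𝓜.raw_zero_add x)⟩ ?_ y
  · obtain ⟨d, hd | hd⟩ := h
    · exact .inl ⟨d, hd⟩
    · exact .inr ⟨d, hd⟩
  · rintro y ⟨d, hd | hd⟩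
    · exact ⟨d + 1, .inl (by rw [𝓜.raw_add_succ, hd])⟩
    · rcases 𝓜.raw_zero_or_succ d with rfl | ⟨c, rfl⟩
      · exact ⟨1, .inl (by rw [← hd, 𝓜.raw_add_zero])⟩
      · exact ⟨c, .inr (by rw [← hd, 𝓜.raw_succ_add, 𝓜.raw_add_succ])⟩

theorem raw_lt_irrefl (𝓜 : Model M) (x : M) : ¬ x < x := by
  rw [𝓜.raw_lt_iff]
  rintro ⟨d, hd⟩
  refine 𝓜.raw_succ_ne_zero d (𝓜.raw_add_right_cancel (z := x) ?_)
  rw [𝓜.raw_add_comm, hd, 𝓜.raw_zero_add]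

/-- The numbers of a model form a commutative semiring. -/
abbrev commSemiring (𝓜 : Model M) : CommSemiring M where
  add_assoc := 𝓜.raw_add_assoc
  zero_add := 𝓜.raw_zero_add
  add_zero := 𝓜.raw_add_zero
  add_comm := 𝓜.raw_add_comm
  nsmul := nsmulRec
  left_distrib := 𝓜.raw_mul_add
  right_distrib x y z := by rw [𝓜.raw_mul_comm, 𝓜.raw_mul_add, 𝓜.raw_mul_comm z, 𝓜.raw_mul_comm z]
  zero_mul := 𝓜.raw_zero_mul
  mul_zero := 𝓜.raw_mul_zero
  mul_assoc := 𝓜.raw_mul_assoc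
  one_mul x := by
    rw [← 𝓜.raw_zero_add 1, 𝓜.raw_succ_mul, 𝓜.raw_zero_mul, 𝓜.raw_zero_add]
  mul_one x := by
    rw [← 𝓜.raw_zero_add 1, 𝓜.raw_mul_succ, 𝓜.raw_mul_zero, 𝓜.raw_zero_add]
  mul_comm := 𝓜.raw_mul_comm

theorem raw_le_iff (𝓜 : Model M) (x y : M) : (x < y ∨ x = y) ↔ ∃ d, x + d = y := by
  rw [𝓜.raw_lt_iff]
  constructor
  · rintro (⟨d, hd⟩ | rfl)
    · exact ⟨d + 1, hd⟩
    · exact ⟨0, 𝓜.raw_add_zero x⟩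
  · rintro ⟨d, rfl⟩
    rcases 𝓜.raw_zero_or_succ d with rfl | ⟨c, rfl⟩
    · exact .inr (𝓜.raw_add_zero x).symm
    · exact .inl ⟨c, rfl⟩

theorem raw_lt_asymm (𝓜 : Model M) {x y : M} (h : x < y) (h' : y < x ∨ y = x) : False := by
  obtain ⟨c, rfl⟩ := (𝓜.raw_lt_iff x y).1 h
  obtain ⟨d, hd⟩ := (𝓜.raw_le_iff _ x).1 h'
  refine 𝓜.raw_lt_irrefl x ((𝓜.raw_lt_iff _ _).2 ⟨c + d, ?_⟩)
  rwa [← 𝓜.raw_succ_add, ← 𝓜.raw_add_assoc]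

open Classical in
/-- The order of a model, with `x ≤ y` read as `x < y ∨ x = y`. -/
noncomputable abbrev linearOrder (𝓜 : Model M) : LinearOrder M where
  le x y := x < y ∨ x = y
  le_refl x := .inr rfl
  le_trans x y z h h' := by
    obtain ⟨c, rfl⟩ := (𝓜.raw_le_iff _ _).1 h
    obtain ⟨d, rfl⟩ := (𝓜.raw_le_iff _ _).1 h'
    exact (𝓜.raw_le_iff _ _).2 ⟨c + d, (𝓜.raw_add_assoc _ _ _).symm⟩
  lt_iff_le_not_ge x y := ⟨fun h => ⟨.inl h, 𝓜.raw_lt_asymm h⟩, fun h =>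
    h.1.resolve_right fun e => h.2 (.inr e.symm)⟩
  le_antisymm x y h h' := h.resolve_left fun hlt => 𝓜.raw_lt_asymm hlt h'
  le_total x y := by
    have h := 𝓜.raw_total x y
    rwa [← 𝓜.raw_le_iff, ← 𝓜.raw_le_iff] at h
  toDecidableLE := Classical.decRel _

end Arithmetic

end Model

/-- Discretely ordered commutative semirings in which every number is `0` or a successor and
`x ≤ y` means that `y - x` exists. -/
class Numbers (M : Type) extends CommSemiring M, LinearOrder M, IsStrictOrderedRing M,
    CanonicallyOrderedAdd M where
  lt_add_one_iff' (x y : M) : x < y + 1 ↔ x ≤ y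

namespace Model

/-- The numbers of a model of `RCA₀` are a discretely ordered semiring. -/
noncomputable abbrev numbers {M : Type} [Zero M] [One M] [Add M] [Mul M] [LT M] (𝓜 : Model M) :
    Numbers M :=
  { 𝓜.commSemiring, 𝓜.linearOrder with
    add_le_add_left := fun x y h z => by
      obtain ⟨d, rfl⟩ := (𝓜.raw_le_iff _ _).1 h
      exact (𝓜.raw_le_iff _ _).2 ⟨d, 𝓜.raw_add_right_comm _ _ _⟩
    le_of_add_le_add_left := fun x y z h => by
      obtain ⟨d, hd⟩ := (𝓜.raw_le_iff _ _).1 h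
      refine (𝓜.raw_le_iff _ _).2 ⟨d, 𝓜.raw_add_right_cancel (z := x) ?_⟩
      rw [𝓜.raw_add_comm, ← 𝓜.raw_add_assoc, hd, 𝓜.raw_add_comm]
    zero_le_one := (𝓜.raw_le_iff _ _).2 ⟨1, 𝓜.raw_zero_add 1⟩
    exists_pair_ne := ⟨0 + 1, 0, 𝓜.raw_succ_ne_zero 0⟩
    mul_lt_mul_of_pos_left := fun x hx y z h => by
      obtain ⟨c, rfl⟩ := (𝓜.raw_lt_iff _ _).1 hx
      obtain ⟨d, rfl⟩ := (𝓜.raw_lt_iff _ _).1 h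
      refine (𝓜.raw_lt_iff _ _).2 ⟨c * d + c + d, ?_⟩
      let := 𝓜.commSemiring
      ring
    mul_lt_mul_of_pos_right := fun x hx y z h => by
      obtain ⟨c, rfl⟩ := (𝓜.raw_lt_iff _ _).1 hx
      obtain ⟨d, rfl⟩ := (𝓜.raw_lt_iff _ _).1 h
      refine (𝓜.raw_lt_iff _ _).2 ⟨c * d + c + d, ?_⟩
      let := 𝓜.commSemiring
      ring
    exists_add_of_le := fun {x y} h => by
      obtain ⟨d, hd⟩ := (𝓜.raw_le_iff _ _).1 h
      exact ⟨d, hd.symm⟩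
    le_add_self := fun x y => (𝓜.raw_le_iff _ _).2 ⟨y, 𝓜.raw_add_comm _ _⟩
    le_self_add := fun x y => (𝓜.raw_le_iff _ _).2 ⟨y, rfl⟩
    lt_add_one_iff' := 𝓜.raw_lt_succ }

end Model

/-! ### The meaning of the defined formulas -/

section Meaning

variable {M : Type} [Numbers M]

/-- The pairing function. -/
def pr (x y : M) : M := (x + y) * (x + y) + x

/-- The number `c` has the form `(k, (m, n))`. -/
def IsTriple (c : M) : Prop :=
  ∃ k, k < c + 1 ∧ ∃ m, m < c + 1 ∧ ∃ n, n < c + 1 ∧ c = pr k (pr m n)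

/-- The number `i` belongs to the finite set described by `c`. -/
def InCode (i c : M) : Prop :=
  ∃ k, k < c + 1 ∧ ∃ m, m < c + 1 ∧ ∃ n, n < c + 1 ∧ c = pr k (pr m n) ∧ i < k ∧
    ∃ d, d < n + 1 ∧ (m * (i + 1) + 1) * d = n

/-- The number `c` is the least description of a finite set. -/
def IsFinCode (c : M) : Prop :=
  IsTriple c ∧ ∀ x, x < c → IsTriple x → ¬ ∀ i, i < c → (InCode i x ↔ InCode i c)

/-- The finite function with code `s` has the value `b` at `i`. -/
def ValIs (s i b : M) : Prop := InCode (pr i b) s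

/-- The finite sequence with code `s` has length `l`. -/
def LhIs (s l : M) : Prop := ∀ a, a < s + 1 → (a < l ↔ ∃ b, b < s + 1 ∧ ValIs s a b)

/-- The number `s` is the code of a finite sequence. -/
def IsSeq (s : M) : Prop :=
  IsFinCode s ∧
  (∀ x, x < s → InCode x s → ∃ a, a < s ∧ ∃ b, b < s ∧ x = pr a b) ∧
  (∃ l, l < s + 1 ∧ LhIs s l) ∧
  ∀ a, a < s → ∀ b, b < s → ∀ c, c < s → ValIs s a b → ValIs s a c → b = c

/-- The number `x` is an entry of the finite sequence with code `l`. -/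
def InA (x l : M) : Prop := ∃ i, i < l ∧ (∃ y, LhIs l y ∧ i < y) ∧ ValIs l i x

/-- The set `f` of pairs is a function from the class `D` to the class `C`. -/
def IsFun (f : Set M) (D C : M → Prop) : Prop :=
  (∀ z, z ∈ f → ∃ x y, z = pr x y ∧ D x ∧ C y) ∧ (∀ x, D x → ∃ y, pr x y ∈ f) ∧
    ∀ x y z, pr x y ∈ f → pr x z ∈ f → y = z

/-- The set `X` is bounded. -/
def IsFinite (X : Set M) : Prop := ∃ b, ∀ x, x ∈ X → x < b

/-- There is, among the sets `S`, a bijection from the numbers below `m` onto the entries of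
`l`. -/
def CardIs (S : Set (Set M)) (l m : M) : Prop :=
  ∃ f ∈ S, IsFun f (fun x => x < m) (fun x => InA x l) ∧
    (∀ x y z, pr x z ∈ f → pr y z ∈ f → x = y) ∧ ∀ x, InA x l → ∃ i, pr i x ∈ f

/-- `l` has more than `F(l)` entries. -/
def CardGtVal (S : Set (Set M)) (F : Set M) (l : M) : Prop :=
  ∃ w, pr l w ∈ F ∧ ∃ m, CardIs S l m ∧ w < m

/-- `F` has the same value at `x` and `y`. -/
def SameVal (F : Set M) (x y : M) : Prop := ∃ w, pr x w ∈ F ∧ pr y w ∈ F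

/-- `F` depends only on the set of entries. -/
def IsExtensional (F : Set M) : Prop :=
  ∀ l l', IsSeq l → IsSeq l' → (∀ x, InA x l ↔ InA x l') → SameVal F l l'

/-- `x` is an entry of member `m` of the sequence `L` of finite sequences. -/
def InAof (x : M) (L : Set M) (m : M) : Prop := ∃ l, pr m l ∈ L ∧ InA x l

/-- `L` is a sequence of finite sequences. -/
def IsSeqOfSeqs (L : Set M) : Prop :=
  IsFun L (fun _ => True) (fun _ => True) ∧ ∀ m l, pr m l ∈ L → IsSeq l

/-- `L` is an increasing sequence of finite sets whose union is among the sets `S`. -/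
def IsNestedWithUnion (S : Set (Set M)) (L : Set M) : Prop :=
  IsSeqOfSeqs L ∧ (∀ m x, InAof x L m → InAof x L (m + 1)) ∧
    ∃ U ∈ S, ∀ x, x ∈ U ↔ ∃ m, InAof x L m

/-- `L` converges to `A` on every bounded set among the sets `S`. -/
def WeaklyConvergesTo (S : Set (Set M)) (L A : Set M) : Prop :=
  ¬ IsFinite A ∧ IsSeqOfSeqs L ∧ ∀ B ∈ S, IsFinite B → ∃ i, ∀ j, i ≤ j →
    ∀ x, (InAof x L j ∧ x ∈ B) ↔ (x ∈ A ∧ x ∈ B)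

/-- `F` is eventually constant along the sequence `L`. -/
def Stabilizes (F L : Set M) : Prop :=
  ∃ i, ∀ j, i ≤ j → ∃ k l, pr i k ∈ L ∧ pr j l ∈ L ∧ SameVal F k l

/-- `F` is a function on numbers that depends only on the set of entries. -/
def IsSetFunction (F : Set M) : Prop :=
  IsFun F (fun _ => True) (fun _ => True) ∧ IsExtensional F

/-- `F` is asymptotically stable. -/
def IsAS (S : Set (Set M)) (F : Set M) : Prop :=
  IsSetFunction F ∧ ∀ L ∈ S, IsNestedWithUnion S L → Stabilizes F L

/-- `F` is asymptotically stable near infinite sets. -/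
def IsASNIS (S : Set (Set M)) (F : Set M) : Prop :=
  IsSetFunction F ∧ ∀ L ∈ S, (∃ A ∈ S, WeaklyConvergesTo S L A) → Stabilizes F L

/-- The infinite pigeonhole principle. -/
def HasIPP (S : Set (Set M)) : Prop :=
  ∀ n : M, ∀ f ∈ S, IsFun f (fun _ => True) (fun y => y ≤ n) →
    ∃ c, c ≤ n ∧ ∃ X ∈ S, (∀ x, x ∈ X ↔ pr x c ∈ f) ∧ ¬ IsFinite X

/-- The first finitary pigeonhole principle. -/
def HasFIPP2 (S : Set (Set M)) : Prop :=
  ∀ n : M, ∀ F ∈ S, IsAS S F → ∃ k, ∀ f ∈ S, IsFun f (fun x => x ≤ k) (fun y => y ≤ n) →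
    ∃ l, IsSeq l ∧ (∀ x, InA x l → x ≤ k) ∧ CardGtVal S F l ∧
      ∀ x y, InA x l → InA y l → SameVal f x y

/-- The second finitary pigeonhole principle. -/
def HasFIPP3 (S : Set (Set M)) : Prop :=
  ∀ n : M, ∀ F ∈ S, IsASNIS S F → ∃ k, ∀ f ∈ S, IsFun f (fun x => x ≤ k) (fun y => y ≤ n) →
    ∃ l, IsSeq l ∧ ∃ c, c ≤ n ∧ (∀ x, InA x l ↔ pr x c ∈ f) ∧ CardGtVal S F l

/-- The codes of the initial segments of length `y` of `f` and `g` are equal. -/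
def Agree (f g : Set M) (y : M) : Prop :=
  ∃ s, (IsSeq s ∧ LhIs s y ∧ ∀ i, i < y → ∀ b, ValIs s i b → pr i b ∈ f) ∧
    IsSeq s ∧ LhIs s y ∧ ∀ i, i < y → ∀ b, ValIs s i b → pr i b ∈ g

variable {S : Set (Set M)} (e : ℕ → M) (s : ℕ → Set M)

@[simp] theorem eval_pair (a b : Tm) : (pair a b).eval e = pr (a.eval e) (b.eval e) := rfl

@[simp] theorem sat_le (a b : Tm) : Sat S (le a b) e s ↔ a.eval e ≤ b.eval e := by
  simp only [le, sat_disj, sat_lt, sat_eq, le_iff_lt_or_eq]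

@[simp] theorem sat_isTriple (c : Tm) : Sat S (isTriple c) e s ↔ IsTriple (c.eval e) := by
  simp [isTriple, IsTriple]

@[simp] theorem sat_inCode (i c : Tm) :
    Sat S (inCode i c) e s ↔ InCode (i.eval e) (c.eval e) := by
  simp [inCode, InCode]

@[simp] theorem sat_isFinCode (c : Tm) : Sat S (isFinCode c) e s ↔ IsFinCode (c.eval e) := by
  simp [isFinCode, IsFinCode]

@[simp] theorem sat_valIs (t i b : Tm) :
    Sat S (valIs t i b) e s ↔ ValIs (t.eval e) (i.eval e) (b.eval e) := by
  simp [valIs, ValIs]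

@[simp] theorem sat_lhIs (t l : Tm) :
    Sat S (lhIs t l) e s ↔ LhIs (t.eval e) (l.eval e) := by
  simp [lhIs, LhIs]

@[simp] theorem sat_isSeq (t : Tm) : Sat S (isSeq t) e s ↔ IsSeq (t.eval e) := by
  simp [isSeq, IsSeq]

@[simp] theorem sat_inA (x l : Tm) : Sat S (inA x l) e s ↔ InA (x.eval e) (l.eval e) := by
  simp [inA, InA]

@[simp] theorem sat_isFun (f : ℕ) (D C : Fml) : Sat S (isFun f D C) e s ↔
    IsFun (s f) (fun x => Sat S D (scons x e) s) (fun x => Sat S C (scons x e) s) := by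
  simp [isFun, IsFun]

@[simp] theorem sat_isFinite (X : ℕ) : Sat S (isFinite X) e s ↔ IsFinite (s X) := by
  simp [isFinite, IsFinite]

@[simp] theorem sat_cardGtVal (F : ℕ) (l : Tm) :
    Sat S (cardGtVal F l) e s ↔ CardGtVal S (s F) (l.eval e) := by
  simp [cardGtVal, CardGtVal, cardGt, cardIs, CardIs]

@[simp] theorem sat_sameVal (F : ℕ) (a b : Tm) :
    Sat S (sameVal F a b) e s ↔ SameVal (s F) (a.eval e) (b.eval e) := by
  simp [sameVal, SameVal]

@[simp] theorem sat_inAof (x : Tm) (L : ℕ) (m : Tm) :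
    Sat S (inAof x L m) e s ↔ InAof (x.eval e) (s L) (m.eval e) := by
  simp [inAof, InAof]

@[simp] theorem sat_isSeqOfSeqs (L : ℕ) : Sat S (isSeqOfSeqs L) e s ↔ IsSeqOfSeqs (s L) := by
  simp [isSeqOfSeqs, IsSeqOfSeqs, isFunNN]

@[simp] theorem sat_stabilizes (F L : ℕ) :
    Sat S (stabilizes F L) e s ↔ Stabilizes (s F) (s L) := by
  simp [stabilizes, Stabilizes]

@[simp] theorem sat_isAS (F : ℕ) : Sat S (isAS F) e s ↔ IsAS S (s F) := by
  simp [isAS, IsAS, isFunNN, isExtensional, IsSetFunction, IsExtensional, isNestedWithUnion,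
    IsNestedWithUnion, and_assoc]

@[simp] theorem sat_isASNIS (F : ℕ) : Sat S (isASNIS F) e s ↔ IsASNIS S (s F) := by
  simp [isASNIS, IsASNIS, isFunNN, isExtensional, IsSetFunction, IsExtensional, weaklyConverges,
    weaklyConvergesTo, WeaklyConvergesTo, isInfinite, and_assoc]

@[simp] theorem sat_IPP : Sat S IPP e s ↔ HasIPP S := by
  simp [IPP, HasIPP, isFunTo, isInfinite]

@[simp] theorem sat_FIPP2 : Sat S FIPP2 e s ↔ HasFIPP2 S := by
  simp [FIPP2, HasFIPP2, isFunFin]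

@[simp] theorem sat_FIPP3 : Sat S FIPP3 e s ↔ HasFIPP3 S := by
  simp [FIPP3, HasFIPP3, isFunFin]

@[simp] theorem sat_agree (f g : ℕ) (y : Tm) :
    Sat S (agree f g y) e s ↔ Agree (s f) (s g) (y.eval e) := by
  simp [agree, Agree, isInit]

end Meaning

/-! ### Continuous uniform boundedness in a model -/

section UniformBoundedness

variable {M : Type} [Numbers M]

/-- `f` is a function from all numbers to the numbers `≤ n`. -/
def IsColoring (n : M) (f : Set M) : Prop := IsFun f (fun _ => True) fun y => y ≤ n

theorem sat_place {S : Set (Set M)} (p d : ℕ) (ρ : ℕ → ℕ) (A : Fml) (e : ℕ → M)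
    (s : ℕ → Set M) : Sat S (place p d ρ A) e s ↔
      Sat S A (fun i => e (if i < p then i else i + d)) fun i => s (ρ i) := by
  rw [place, sat_subst]
  refine iff_of_eq ?_
  congr 1
  funext i
  split_ifs <;> rfl

/-- Uniform boundedness for a formula with two distinguished number variables. -/
theorem cub_two {𝓜 : Model M} {Γ : Fml → Prop}
    (hC : ∀ B ∈ CUB Γ, ∀ e s, (∀ i, s i ∈ 𝓜.S) → Sat 𝓜.S B e s) {A : Fml} (hA : Γ A)
    {R : M → M → Set M → Prop}
    (hR : ∀ x y X, R x y X ↔ Sat 𝓜.S A (scons x (scons y 𝓜.num)) (scons X 𝓜.set)) (n : M)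
    (hcont : ∀ f ∈ 𝓜.S, IsColoring n f → ∀ z, ∃ y, ∀ g ∈ 𝓜.S, IsColoring n g → Agree f g y →
      ∀ a b, a ≤ z → b ≤ z → (R a b f ↔ R a b g))
    (hex : ∀ f ∈ 𝓜.S, IsColoring n f → ∃ a b, R a b f) :
    ∃ z, ∀ f ∈ 𝓜.S, IsColoring n f → ∃ a b, a ≤ z ∧ b ≤ z ∧ R a b f := by
  -- The environment in which `place` evaluates the formula.
  have env : ∀ (b a : M) (e : ℕ → M) (d : ℕ), (∀ i, e (i + d) = 𝓜.num i) →
      (fun i => scons b (scons a e) (if i < 2 then i else i + d)) =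
        scons b (scons a 𝓜.num) := by
    intro b a e d h
    funext i
    rcases i with _ | _ | i
    · rfl
    · rfl
    · rw [if_neg (by omega), show i + 1 + 1 + d = (i + d) + 1 + 1 by omega, scons_succ, scons_succ,
        scons_succ, scons_succ, h]
  have hs := hC _ ⟨2, A, hA, rfl⟩ 𝓜.num (fun i => 𝓜.set i) 𝓜.set_mem
  simp only [cubFor, cont, allBlock, exBlock, blockLe, isFunTo, sat_allN, sat_imp, sat_conj,
    sat_allS, sat_isFun, sat_top, sat_exN, sat_agree, sat_place, sat_iff, sat_le, Tm.eval_v,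
    Tm.eval_lift, scons_zero, scons_succ, true_and] at hs
  have h := hs n ⟨?_, ?_⟩
  · obtain ⟨z, hz⟩ := h
    refine ⟨z, fun f hf hfn => ?_⟩
    obtain ⟨a, b, ⟨hb, ha⟩, hR'⟩ := hz f hf hfn
    refine ⟨b, a, hb, ha, (hR _ _ _).2 ?_⟩
    rw [env _ _ _ _ fun i => rfl] at hR'
    exact hR'
  · intro f hf hfn z
    obtain ⟨y, hy⟩ := hcont f hf hfn z
    refine ⟨y, fun g hg hgn hag a b hab => ?_⟩
    have := hy g hg hgn hag b a hab.1 hab.2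
    rw [hR, hR] at this
    rw [env _ _ _ _ fun i => rfl]
    convert this using 2
    exact eq_scons rfl fun _ => rfl
  · intro f hf hfn
    obtain ⟨a, b, hab⟩ := hex f hf hfn
    refine ⟨b, a, ?_⟩
    rw [env _ _ _ _ fun i => rfl]
    convert (hR _ _ _).1 hab using 1
    exact eq_scons rfl fun _ => rfl

/-- Uniform boundedness for a formula with one distinguished number variable. -/
theorem cub_one {𝓜 : Model M} {Γ : Fml → Prop}
    (hC : ∀ B ∈ CUB Γ, ∀ e s, (∀ i, s i ∈ 𝓜.S) → Sat 𝓜.S B e s) {A : Fml} (hA : Γ A)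
    {R : M → Set M → Prop}
    (hR : ∀ x X, R x X ↔ Sat 𝓜.S A (scons x 𝓜.num) (scons X 𝓜.set)) (n : M)
    (hcont : ∀ f ∈ 𝓜.S, IsColoring n f → ∀ z, ∃ y, ∀ g ∈ 𝓜.S, IsColoring n g → Agree f g y →
      ∀ a, a ≤ z → (R a f ↔ R a g))
    (hex : ∀ f ∈ 𝓜.S, IsColoring n f → ∃ a, R a f) :
    ∃ z, ∀ f ∈ 𝓜.S, IsColoring n f → ∃ a, a ≤ z ∧ R a f := by
  -- The environment in which `place` evaluates the formula.
  have env : ∀ (a : M) (e : ℕ → M) (d : ℕ), (∀ i, e (i + d) = 𝓜.num i) →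
      (fun i => scons a e (if i < 1 then i else i + d)) = scons a 𝓜.num := by
    intro a e d h
    funext i
    rcases i with _ | i
    · rfl
    · rw [if_neg (by omega), show i + 1 + d = (i + d) + 1 by omega, scons_succ, scons_succ, h]
  have hs := hC _ ⟨1, A, hA, rfl⟩ 𝓜.num (fun i => 𝓜.set i) 𝓜.set_mem
  simp only [cubFor, cont, allBlock, exBlock, blockLe, isFunTo, sat_allN, sat_imp, sat_conj,
    sat_allS, sat_isFun, sat_top, sat_exN, sat_agree, sat_place, sat_iff, sat_le, Tm.eval_v,
    Tm.eval_lift, scons_zero, scons_succ, true_and] at hs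
  have h := hs n ⟨?_, ?_⟩
  · obtain ⟨z, hz⟩ := h
    refine ⟨z, fun f hf hfn => ?_⟩
    obtain ⟨a, ha, hR'⟩ := hz f hf hfn
    refine ⟨a, ha, (hR _ _).2 ?_⟩
    rw [env _ _ _ fun i => rfl] at hR'
    exact hR'
  · intro f hf hfn z
    obtain ⟨y, hy⟩ := hcont f hf hfn z
    refine ⟨y, fun g hg hgn hag a ha => ?_⟩
    have := hy g hg hgn hag a ha
    rw [hR, hR] at this
    rw [env _ _ _ fun i => rfl]
    convert this using 2
    exact eq_scons rfl fun _ => rfl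
  · intro f hf hfn
    obtain ⟨a, ha⟩ := hex f hf hfn
    refine ⟨a, ?_⟩
    rw [env _ _ _ fun i => rfl]
    convert (hR _ _).1 ha using 1
    exact eq_scons rfl fun _ => rfl

/-- `Σ⁰₀`-`CUB` for a bounded condition with two distinguished numbers. -/
theorem sigma00_cub {𝓜 : Model M}
    (hC : ∀ B ∈ CUB Sigma00, ∀ e s, (∀ i, s i ∈ 𝓜.S) → Sat 𝓜.S B e s)
    {R : M → M → Set M → Prop} (hR : 𝓜.Bounded fun e X => R (e 0) (e 1) X) (n : M)
    (hcont : ∀ f ∈ 𝓜.S, IsColoring n f → ∀ z, ∃ y, ∀ g ∈ 𝓜.S, IsColoring n g → Agree f g y →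
      ∀ a b, a ≤ z → b ≤ z → (R a b f ↔ R a b g))
    (hex : ∀ f ∈ 𝓜.S, IsColoring n f → ∃ a b, R a b f) :
    ∃ z, ∀ f ∈ 𝓜.S, IsColoring n f → ∃ a b, a ≤ z ∧ b ≤ z ∧ R a b f := by
  obtain ⟨A, hA, hAs⟩ := hR.exists_formula
  exact cub_two hC hA hAs n hcont hex

/-- `Π⁰₁`-`CUB` for a condition `∀ t R(t, x, f)` with one distinguished number `x`. -/
theorem pi01_cub {𝓜 : Model M}
    (hC : ∀ B ∈ CUB Pi01, ∀ e s, (∀ i, s i ∈ 𝓜.S) → Sat 𝓜.S B e s)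
    {R : M → M → Set M → Prop} (hR : 𝓜.Bounded fun e X => R (e 0) (e 1) X) (n : M)
    (hcont : ∀ f ∈ 𝓜.S, IsColoring n f → ∀ z, ∃ y, ∀ g ∈ 𝓜.S, IsColoring n g → Agree f g y →
      ∀ a, a ≤ z → ((∀ t, R t a f) ↔ ∀ t, R t a g))
    (hex : ∀ f ∈ 𝓜.S, IsColoring n f → ∃ a, ∀ t, R t a f) :
    ∃ z, ∀ f ∈ 𝓜.S, IsColoring n f → ∃ a, a ≤ z ∧ ∀ t, R t a f := by
  obtain ⟨A, hA, hAs⟩ := hR.exists_formula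
  refine cub_one (R := fun x X => ∀ t, R t x X) hC ⟨A, hA, rfl⟩ (fun x X => ?_) n hcont hex
  rw [sat_allN]
  exact forall_congr' fun t => hAs t x X

end UniformBoundedness

/-! ### Pairs and divisibility -/

namespace Numbers

variable {M : Type} [Numbers M]

theorem lt_succ {x y : M} : x < y + 1 ↔ x ≤ y := lt_add_one_iff' x y

theorem succ_le {x y : M} : x + 1 ≤ y ↔ x < y := by
  rw [← not_lt, lt_succ, not_le]

theorem lt_self_succ (x : M) : x < x + 1 := lt_succ.2 le_rfl

theorem one_le {x : M} (h : x ≠ 0) : 1 ≤ x := by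
  have := succ_le.2 (pos_iff_ne_zero.2 h)
  rwa [zero_add] at this

theorem le_mul_self (x : M) : x ≤ x * x := by
  rcases eq_or_ne x 0 with rfl | h
  · simp
  · exact le_mul_of_one_le_left (zero_le) (one_le h)

theorem left_le_pr (x y : M) : x ≤ pr x y := le_add_self

theorem right_le_pr (x y : M) : y ≤ pr x y :=
  le_add_self.trans ((le_mul_self (x + y)).trans le_self_add)

theorem pr_lt_pr_of_add_lt {x y x' y' : M} (h : x + y < x' + y') : pr x y < pr x' y' := by
  have h1 : (x + y + 1) * (x + y + 1) ≤ (x' + y') * (x' + y') := by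
    have := succ_le.2 h
    gcongr
  calc pr x y ≤ (x + y) * (x + y) + (x + y) := by
        unfold pr
        gcongr
        exact le_self_add
    _ < (x + y) * (x + y) + (x + y) + (x + y) + 1 := lt_succ.2 le_self_add
    _ = (x + y + 1) * (x + y + 1) := by ring
    _ ≤ (x' + y') * (x' + y') := h1
    _ ≤ pr x' y' := le_self_add

theorem pr_inj {x y x' y' : M} : pr x y = pr x' y' ↔ x = x' ∧ y = y' := by
  refine ⟨fun h => ?_, by rintro ⟨rfl, rfl⟩; rfl⟩
  rcases lt_trichotomy (x + y) (x' + y') with hlt | heq | hgt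
  · exact absurd h (pr_lt_pr_of_add_lt hlt).ne
  · unfold pr at h
    rw [heq] at h
    obtain rfl := add_left_cancel h
    exact ⟨rfl, add_left_cancel heq⟩
  · exact absurd h (pr_lt_pr_of_add_lt hgt).ne'

/-- Divisibility with a bounded cofactor; for `y = 0` the cofactor `0` is chosen. -/
theorem dvd_iff_bounded {x y : M} : x ∣ y ↔ ∃ d, d < y + 1 ∧ x * d = y := by
  refine ⟨?_, fun ⟨d, _, hd⟩ => ⟨d, hd.symm⟩⟩
  rintro ⟨d, rfl⟩
  rcases eq_or_ne x 0 with rfl | hx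
  · exact ⟨0, lt_succ.2 zero_le, by simp⟩
  · exact ⟨d, lt_succ.2 (le_mul_of_one_le_left zero_le (one_le hx)), rfl⟩

theorem dvd_of_dvd_add {p a b : M} (h : p ∣ a + b) (ha : p ∣ a) : p ∣ b := by
  obtain ⟨c, hc⟩ := h
  obtain ⟨d, rfl⟩ := ha
  rcases le_total d c with hdc | hcd
  · obtain ⟨e, rfl⟩ := exists_add_of_le hdc
    rw [mul_add] at hc
    exact ⟨e, add_left_cancel hc⟩
  · obtain ⟨e, rfl⟩ := exists_add_of_le hcd
    rw [mul_add, add_assoc] at hc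
    have h0 : p * e + b = 0 := add_left_cancel (hc.trans (add_zero _).symm)
    rw [(add_eq_zero.1 h0).2]
    exact dvd_zero p

/-- Modulo `a + 1`, the number `a` is `-1`. -/
theorem succ_dvd_of_dvd_mul {a n : M} (h : a + 1 ∣ n * a) : a + 1 ∣ n := by
  refine dvd_of_dvd_add (a := n * a) ⟨n, ?_⟩ h
  ring

/-- The numbers `m (i + 1) + 1` for `i < k` are pairwise coprime if all positive numbers up to
`k` divide `m`; this is the instance of Euclid's lemma that coding needs. Modulo `p = m (i + 1) + 1`
the difference to another such number is `m t` with `t ∣ m`, and `m (i + 1)` is `-1`. -/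
theorem beta_coprime {m k n i j : M} (hm : ∀ t, t < k → t + 1 ∣ m) (hi : i < k) (hj : j < k)
    (hij : i ≠ j) (h : m * (i + 1) + 1 ∣ n * (m * (j + 1) + 1)) : m * (i + 1) + 1 ∣ n := by
  have key : ∀ t, t + 1 ∣ m → m * (i + 1) + 1 ∣ n * (m * (t + 1)) → m * (i + 1) + 1 ∣ n := by
    rintro t ⟨q, hq⟩ h
    have h1 : m * (i + 1) + 1 ∣ n * (m * (i + 1)) * (m * (i + 1)) := by
      refine (h.mul_right (q * (i + 1) * (i + 1))).trans (dvd_of_eq ?_)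
      calc n * (m * (t + 1)) * (q * (i + 1) * (i + 1))
          = n * m * ((t + 1) * q) * (i + 1) * (i + 1) := by ring
        _ = n * (m * (i + 1)) * (m * (i + 1)) := by rw [← hq]; ring
    exact succ_dvd_of_dvd_mul (succ_dvd_of_dvd_mul h1)
  rcases lt_or_gt_of_ne hij with hlt | hgt
  · obtain ⟨t, rfl⟩ := exists_add_of_le (succ_le.2 hlt)
    refine key t (hm t (lt_of_le_of_lt le_add_self hj)) ?_
    refine dvd_of_dvd_add (a := n * (m * (i + 1) + 1)) ?_ (dvd_mul_left _ _)
    convert h using 1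
    ring
  · obtain ⟨t, rfl⟩ := exists_add_of_le (succ_le.2 hgt)
    refine key t (hm t (lt_of_le_of_lt le_add_self hi)) (dvd_of_dvd_add ?_ h)
    refine (dvd_mul_left _ n).trans (dvd_of_eq ?_)
    ring

end Numbers

open Numbers

section Sequences

variable {M : Type} [Numbers M]

theorem inCode_pr {i k m n : M} :
    InCode i (pr k (pr m n)) ↔ i < k ∧ m * (i + 1) + 1 ∣ n := by
  rw [dvd_iff_bounded]
  constructor
  · rintro ⟨k', -, m', -, n', -, h, hi, hd⟩
    simp only [pr_inj] at h
    obtain ⟨rfl, rfl, rfl⟩ := h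
    exact ⟨hi, hd⟩
  · rintro ⟨hi, hd⟩
    exact ⟨k, lt_succ.2 (left_le_pr _ _), m, lt_succ.2 ((left_le_pr _ _).trans (right_le_pr _ _)), n,
      lt_succ.2 ((right_le_pr _ _).trans (right_le_pr _ _)), rfl, hi, hd⟩

theorem lt_of_inCode {i c : M} (h : InCode i c) : i < c := by
  obtain ⟨k, hk, m, -, n, -, -, hi, -⟩ := h
  exact hi.trans_le (lt_succ.1 hk)

theorem lt_of_valIs {s a b : M} (h : ValIs s a b) : a < s ∧ b < s :=
  ⟨(left_le_pr _ _).trans_lt (lt_of_inCode h), (right_le_pr _ _).trans_lt (lt_of_inCode h)⟩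

/-- The bounds in the definition of the length can be dropped. -/
theorem lhIs_iff {s y : M} : LhIs s y ↔ ∀ a, a < y ↔ ∃ b, ValIs s a b := by
  constructor
  · intro h a
    have hy : y ≤ s := by
      by_contra! hlt
      obtain ⟨b, -, hb⟩ := (h s (lt_self_succ s)).1 hlt
      exact (lt_of_valIs hb).1.false
    constructor
    · intro ha
      obtain ⟨b, -, hb⟩ := (h a (lt_succ.2 (ha.le.trans hy))).1 ha
      exact ⟨b, hb⟩
    · rintro ⟨b, hb⟩
      exact (h a ((lt_of_valIs hb).1.trans (lt_self_succ s))).2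
        ⟨b, (lt_of_valIs hb).2.trans (lt_self_succ s), hb⟩
  · intro h a _
    rw [h a]
    exact ⟨fun ⟨b, hb⟩ => ⟨b, (lt_of_valIs hb).2.trans (lt_self_succ s), hb⟩,
      fun ⟨b, _, hb⟩ => ⟨b, hb⟩⟩

theorem lh_le {s y : M} (h : LhIs s y) : y ≤ s := by
  by_contra! hlt
  obtain ⟨b, hb⟩ := (lhIs_iff.1 h s).1 hlt
  exact (lt_of_valIs hb).1.false

theorem IsSeq.exists_lh {s : M} (h : IsSeq s) : ∃ y, LhIs s y := by
  obtain ⟨-, -, ⟨y, -, hy⟩, -⟩ := h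
  exact ⟨y, hy⟩

theorem IsSeq.val_unique {s a b c : M} (h : IsSeq s) (hb : ValIs s a b) (hc : ValIs s a c) :
    b = c :=
  h.2.2.2 a (lt_of_valIs hb).1 b (lt_of_valIs hb).2 c (lt_of_valIs hc).2 hb hc

theorem IsSeq.inA_iff {s x : M} (h : IsSeq s) : InA x s ↔ ∃ i, ValIs s i x := by
  constructor
  · rintro ⟨i, -, -, hi⟩
    exact ⟨i, hi⟩
  · rintro ⟨i, hi⟩
    obtain ⟨y, hy⟩ := h.exists_lh
    exact ⟨i, (lt_of_valIs hi).1, ⟨y, hy, (lhIs_iff.1 hy i).2 ⟨x, hi⟩⟩, hi⟩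

end Sequences

namespace Model

variable {M : Type} [Numbers M] {𝓜 : Model M}

theorem IsTerm.pr {t u : (ℕ → M) → M} (ht : 𝓜.IsTerm t) (hu : 𝓜.IsTerm u) :
    𝓜.IsTerm fun e => pr (t e) (u e) := ((ht.add hu).mul (ht.add hu)).add ht

namespace Bounded

variable {t u w : (ℕ → M) → M}

theorem le (ht : 𝓜.IsTerm t) (hu : 𝓜.IsTerm u) : 𝓜.Bounded fun e _ => t e ≤ u e :=
  (lt ht (hu.add (.const 1))).congr fun _ _ => lt_succ.symm

theorem ballLe {R : M → (ℕ → M) → Set M → Prop} (ht : 𝓜.IsTerm t)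
    (hR : 𝓜.Bounded fun e X => R (e 0) (fun i => e (i + 1)) X) :
    𝓜.Bounded fun e X => ∀ x, x ≤ t e → R x e X :=
  (ball (ht.add (.const 1)) hR).congr fun _ _ => by simp only [lt_succ]

theorem bexLe {R : M → (ℕ → M) → Set M → Prop} (ht : 𝓜.IsTerm t)
    (hR : 𝓜.Bounded fun e X => R (e 0) (fun i => e (i + 1)) X) :
    𝓜.Bounded fun e X => ∃ x, x ≤ t e ∧ R x e X :=
  (bex (ht.add (.const 1)) hR).congr fun _ _ => by simp only [lt_succ]

theorem dvd (ht : 𝓜.IsTerm t) (hu : 𝓜.IsTerm u) : 𝓜.Bounded fun e _ => t e ∣ u e :=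
  (comp₂ (R := fun x y => ∃ d, d < y + 1 ∧ x * d = y) .arith ht hu).congr
    fun _ _ => dvd_iff_bounded

theorem inCode (ht : 𝓜.IsTerm t) (hu : 𝓜.IsTerm u) :
    𝓜.Bounded fun e _ => InCode (t e) (u e) :=
  comp₂ (by simp only [InCode, SOA.pr]; exact .arith) ht hu

theorem isTriple (ht : 𝓜.IsTerm t) : 𝓜.Bounded fun e _ => IsTriple (t e) :=
  comp₁ (by simp only [IsTriple, SOA.pr]; exact .arith) ht

theorem valIs (ht : 𝓜.IsTerm t) (hu : 𝓜.IsTerm u) (hw : 𝓜.IsTerm w) :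
    𝓜.Bounded fun e _ => ValIs (t e) (u e) (w e) := inCode (hu.pr hw) ht

theorem lhIs (ht : 𝓜.IsTerm t) (hu : 𝓜.IsTerm u) :
    𝓜.Bounded fun e _ => LhIs (t e) (u e) :=
  comp₂ (by simp only [LhIs, ValIs, InCode, SOA.pr]; exact .arith) ht hu

theorem isSeq (ht : 𝓜.IsTerm t) : 𝓜.Bounded fun e _ => IsSeq (t e) :=
  comp₁ (by
    simp only [IsSeq, IsFinCode, IsTriple, LhIs, ValIs, InCode, SOA.pr]
    exact .arith) ht

/-- Bounded definability of conditions built from numerical terms, from sets of the model known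
by assumption, and from the notions of coding. -/
theorem auto {P : (ℕ → M) → Set M → Prop} (h : 𝓜.Bounded P := by
  repeat' first
    | assumption
    | with_reducible exact SOA.Model.IsTerm.var _
    | with_reducible exact SOA.Model.IsTerm.const _
    | with_reducible apply SOA.Model.IsTerm.pr
    | with_reducible apply SOA.Model.IsTerm.add
    | with_reducible apply SOA.Model.IsTerm.mul
    | with_reducible exact SOA.Model.Bounded.const _
    | with_reducible apply SOA.Model.Bounded.eq
    | with_reducible apply SOA.Model.Bounded.lt
    | with_reducible apply SOA.Model.Bounded.le
    | with_reducible apply SOA.Model.Bounded.dvd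
    | with_reducible apply SOA.Model.Bounded.mem
    | with_reducible apply SOA.Model.Bounded.memVar
    | with_reducible apply SOA.Model.Bounded.inCode
    | with_reducible apply SOA.Model.Bounded.isTriple
    | with_reducible apply SOA.Model.Bounded.valIs
    | with_reducible apply SOA.Model.Bounded.lhIs
    | with_reducible apply SOA.Model.Bounded.isSeq
    | with_reducible apply SOA.Model.Bounded.not
    | with_reducible apply SOA.Model.Bounded.and
    | with_reducible apply SOA.Model.Bounded.or
    | with_reducible apply SOA.Model.Bounded.iff
    | with_reducible apply SOA.Model.Bounded.ball
    | with_reducible apply SOA.Model.Bounded.bex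
    | with_reducible apply SOA.Model.Bounded.ballLe
    | with_reducible apply SOA.Model.Bounded.bexLe
    | with_reducible apply SOA.Model.Bounded.imp
    | with_reducible apply_assumption) : 𝓜.Bounded P := h

end Bounded

/-! ### Least elements, collection and codes of finite sets -/

/-- The least number principle for bounded conditions. -/
theorem exists_least {R : M → Prop} (hR : 𝓜.Bounded fun e _ => R (e 0)) {x : M} (hx : R x) :
    ∃ m, R m ∧ ∀ y, y < m → ¬ R y := by
  by_contra! h
  have key := 𝓜.induction (R := fun x => ∀ y, y < x → ¬ R y) .auto
    (fun y hy => (not_lt_zero hy).elim) (fun x ih y hy hRy => ?_) (x + 1)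
  · exact key x (lt_self_succ x) hx
  · rcases (lt_succ.1 hy).eq_or_lt with rfl | hlt
    · obtain ⟨z, hz, hRz⟩ := h y hRy
      exact ih z hz hRz
    · exact ih y hlt hRy

/-- `Σ⁰₁` collection. -/
theorem collection {R : M → M → Prop} (hR : 𝓜.Bounded fun e _ => R (e 0) (e 1)) (y : M)
    (h : ∀ i, i < y → ∃ j, R i j) : ∃ B, ∀ i, i < y → ∃ j, j < B ∧ R i j := by
  have hR' : 𝓜.Bounded fun e _ => R (e 1) (e 0) := hR.comp₂ (.var 1) (.var 0)
  have key := 𝓜.induction_exists (R := fun x B => x ≤ y → ∀ i, i < x → ∃ j, j < B ∧ R i j)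
    ?_ ⟨0, fun _ i hi => (not_lt_zero hi).elim⟩ ?_ y
  · obtain ⟨B, hB⟩ := key
    exact ⟨B, hB le_rfl⟩
  · exact .imp .auto (.ball (.var 0) (.bex (.var 2) (hR.comp₂ (.var 1) (.var 0))))
  · rintro x ⟨B, hB⟩
    by_cases hx : x < y
    · obtain ⟨j, hj⟩ := h x hx
      refine ⟨B + (j + 1), fun _ i hi => ?_⟩
      rcases (lt_succ.1 hi).eq_or_lt with rfl | hlt
      · exact ⟨j, lt_of_lt_of_le (lt_self_succ j) le_add_self, hj⟩
      · obtain ⟨j', hj', hR''⟩ := hB hx.le i hlt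
        exact ⟨j', lt_of_lt_of_le hj' le_self_add, hR''⟩
    · exact ⟨0, fun h => (hx (succ_le.1 h)).elim⟩

theorem exists_common_multiple (𝓜 : Model M) (k : M) :
    ∃ m : M, m ≠ 0 ∧ ∀ j, j < k → j + 1 ∣ m := by
  refine 𝓜.induction_exists (R := fun k m => m ≠ 0 ∧ ∀ j, j < k → j + 1 ∣ m) .auto
    ⟨1, one_ne_zero, fun j hj => (not_lt_zero hj).elim⟩ ?_ k
  rintro k ⟨m, hm, hk⟩
  refine ⟨m * (k + 1), mul_ne_zero hm (zero_le.trans_lt (lt_self_succ k)).ne', fun j hj => ?_⟩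
  rcases (lt_succ.1 hj).eq_or_lt with rfl | hlt
  · exact dvd_mul_left _ _
  · exact (hk j hlt).mul_right _

/-- Every bounded part of a set is described by a number. -/
theorem exists_code {X : Set M} (hX : X ∈ 𝓜.S) (k : M) :
    ∃ c, IsTriple c ∧ ∀ i, InCode i c ↔ i < k ∧ i ∈ X := by
  obtain ⟨m, hm0, hm⟩ := exists_common_multiple 𝓜 k
  -- The number `n` is the product of the `m (i + 1) + 1` with `i < j` and `i ∈ X`.
  have key := 𝓜.induction_exists
    (R := fun j n => j ≤ k → ∀ i, i < k → (m * (i + 1) + 1 ∣ n ↔ i ∈ X ∧ i < j)) .auto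
    ⟨1, fun _ i _ => ?_⟩ ?_ k
  · obtain ⟨n, hn⟩ := key
    refine ⟨pr k (pr m n), ?_, fun i => ?_⟩
    · exact ⟨k, lt_succ.2 (left_le_pr _ _), m,
        lt_succ.2 ((left_le_pr _ _).trans (right_le_pr _ _)), n,
        lt_succ.2 ((right_le_pr _ _).trans (right_le_pr _ _)), rfl⟩
    · rw [inCode_pr]
      refine and_congr_right fun hi => ?_
      rw [hn le_rfl i hi]
      exact and_iff_left hi
  · refine ⟨fun h => ?_, fun h => (not_lt_zero h.2).elim⟩
    obtain ⟨d, hd⟩ := h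
    have hd0 : d ≠ 0 := by
      rintro rfl
      simp at hd
    have h1 : m * (i + 1) + 1 ≤ 0 + 1 := by
      rw [zero_add]
      exact (le_mul_of_one_le_right zero_le (Numbers.one_le hd0)).trans hd.ge
    rw [succ_le, lt_succ, nonpos_iff_eq_zero] at h1
    exact absurd h1 (mul_ne_zero hm0 (zero_le.trans_lt (lt_self_succ i)).ne')
  · rintro j ⟨n, hn⟩
    by_cases hjX : j < k ∧ j ∈ X
    · obtain ⟨hjk, hjX⟩ := hjX
      refine ⟨n * (m * (j + 1) + 1), fun _ i hi => ?_⟩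
      rcases eq_or_ne i j with rfl | hij
      · exact ⟨fun _ => ⟨hjX, lt_self_succ i⟩, fun _ => dvd_mul_left _ _⟩
      · have h1 : i < j + 1 ↔ i < j := by
          rw [lt_succ]
          exact ⟨fun h => h.lt_of_ne hij, le_of_lt⟩
        rw [h1, ← hn hjk.le i hi]
        exact ⟨beta_coprime hm hi hjk hij, fun h => h.mul_right _⟩
    · refine ⟨n, fun hj i hi => ?_⟩
      rw [hn ((lt_self_succ j).le.trans hj) i hi]
      refine and_congr_right fun hiX => ⟨fun h => h.trans (lt_self_succ j), fun h => ?_⟩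
      refine (lt_succ.1 h).lt_of_ne ?_
      rintro rfl
      exact hjX ⟨hi, hiX⟩

/-- Every bounded part of a set has a code. -/
theorem exists_finCode {X : Set M} (hX : X ∈ 𝓜.S) (k : M) :
    ∃ c, IsFinCode c ∧ ∀ i, InCode i c ↔ i < k ∧ i ∈ X := by
  obtain ⟨c, hct, hc⟩ := exists_code hX k
  obtain ⟨c', ⟨hc't, hc'⟩, hmin⟩ := 𝓜.exists_least
    (R := fun x => IsTriple x ∧ ∀ i, i < c → (InCode i x ↔ InCode i c)) .auto
    ⟨hct, fun i _ => Iff.rfl⟩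
  have hle : c' ≤ c := not_lt.1 fun h => hmin c h ⟨hct, fun i _ => Iff.rfl⟩
  refine ⟨c', ⟨hc't, fun x hx hxt hxi => ?_⟩, fun i => ?_⟩
  · refine hmin x hx ⟨hxt, fun i hi => ?_⟩
    rw [← hc' i hi]
    rcases lt_or_ge i c' with h | h
    · exact hxi i h
    · exact iff_of_false (fun h' => (h.trans_lt (lt_of_inCode h')).not_ge hx.le)
        fun h' => (h.trans_lt (lt_of_inCode h')).false
  · rw [← hc i]
    rcases lt_or_ge i c with h | h
    · exact hc' i h
    · exact iff_of_false (fun h' => ((hle.trans h).trans_lt (lt_of_inCode h')).false)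
        fun h' => (h.trans_lt (lt_of_inCode h')).false

/-! ### Codes of initial segments -/

/-- Initial segments of functions of the model have codes. -/
theorem exists_seq {X : Set M} (hX : X ∈ 𝓜.S) {y : M} (hex : ∀ i, i < y → ∃ b, pr i b ∈ X)
    (huniq : ∀ i b c, i < y → pr i b ∈ X → pr i c ∈ X → b = c) :
    ∃ s, IsSeq s ∧ LhIs s y ∧ ∀ i b, ValIs s i b ↔ i < y ∧ pr i b ∈ X := by
  obtain ⟨B, hB⟩ := 𝓜.collection (R := fun i b => pr i b ∈ X) .auto y hex
  have hY : {x | x ∈ X ∧ ∃ i, i < y ∧ ∃ b, b < B ∧ x = pr i b} ∈ 𝓜.S := 𝓜.comprehension .auto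
  obtain ⟨s, hs, hsi⟩ := exists_finCode hY (pr y B)
  have hval : ∀ i b, ValIs s i b ↔ i < y ∧ pr i b ∈ X := by
    intro i b
    unfold ValIs
    rw [hsi]
    constructor
    · rintro ⟨-, hX, i', hi', b', -, h⟩
      obtain ⟨rfl, rfl⟩ := pr_inj.1 h
      exact ⟨hi', hX⟩
    · rintro ⟨hi, hib⟩
      obtain ⟨b', hb', hib'⟩ := hB i hi
      obtain rfl := huniq i _ _ hi hib hib'
      exact ⟨pr_lt_pr_of_add_lt (add_lt_add hi hb'), hib, i, hi, b, hb', rfl⟩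
  have hlh : LhIs s y := lhIs_iff.2 fun a => by
    simp only [hval, exists_and_left]
    exact ⟨fun h => ⟨h, hex a h⟩, fun h => h.1⟩
  refine ⟨s, ⟨hs, fun x _ hxs => ?_, ⟨y, lt_succ.2 (lh_le hlh), hlh⟩, fun a _ b _ c _ hb hc => ?_⟩,
    hlh, hval⟩
  · obtain ⟨-, -, i, -, b, -, rfl⟩ := (hsi x).1 hxs
    exact ⟨i, (lt_of_valIs hxs).1, b, (lt_of_valIs hxs).2, rfl⟩
  · rw [hval] at hb hc
    exact huniq a b c hb.1 hb.2 hc.2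

end Model

/-! ### Increasing lists -/

section Lists

variable {M : Type} [Numbers M]

/-- `l` is a strictly increasing finite sequence. -/
def IsIncreasing (l : M) : Prop :=
  IsSeq l ∧ ∀ i, i < l → ∀ j, j < l → ∀ b, b < l → ∀ c, c < l →
    i < j → ValIs l i b → ValIs l j c → b < c

/-- `l` lists, in increasing order, the numbers below `k` with property `P`. -/
def Lists (l : M) (P : M → Prop) (k : M) : Prop :=
  IsIncreasing l ∧ (∀ i, i < l → ∀ x, x < l → ValIs l i x → x < k ∧ P x) ∧
    ∀ x, x < k → P x → ∃ i, i < l ∧ ValIs l i x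

theorem IsIncreasing.lt {l i j b c : M} (h : IsIncreasing l) (hij : i < j) (hb : ValIs l i b)
    (hc : ValIs l j c) : b < c :=
  h.2 i (lt_of_valIs hb).1 j (lt_of_valIs hc).1 b (lt_of_valIs hb).2 c (lt_of_valIs hc).2 hij hb hc

theorem IsIncreasing.index_lt {l i j b c : M} (h : IsIncreasing l) (hbc : b < c)
    (hb : ValIs l i b) (hc : ValIs l j c) : i < j := by
  rcases lt_trichotomy i j with hij | rfl | hij
  · exact hij
  · exact absurd (h.1.val_unique hb hc) hbc.ne
  · exact absurd (h.lt hij hc hb) hbc.not_gt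

theorem IsIncreasing.injective {l i j b : M} (h : IsIncreasing l) (hb : ValIs l i b)
    (hc : ValIs l j b) : i = j := by
  rcases lt_trichotomy i j with hij | hij | hij
  · exact absurd (h.lt hij hb hc) (lt_irrefl b)
  · exact hij
  · exact absurd (h.lt hij hc hb) (lt_irrefl b)

theorem Lists.inA_iff {l k x : M} {P : M → Prop} (h : Lists l P k) : InA x l ↔ x < k ∧ P x := by
  rw [h.1.1.inA_iff]
  exact ⟨fun ⟨i, hi⟩ => h.2.1 i (lt_of_valIs hi).1 x (lt_of_valIs hi).2 hi,
    fun hx => (h.2.2 x hx.1 hx.2).imp fun _ hi => hi.2⟩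

end Lists

namespace Model

variable {M : Type} [Numbers M] {𝓜 : Model M}

/-! ### Choice in a model -/

/-- If for every `k` there is an `l` with a witness `s` for a bounded condition, then such `l` are
chosen by a function of the model: take the least pair `(l, s)`. -/
theorem choice {R : M → M → M → Prop} (hR : 𝓜.Bounded fun e _ => R (e 0) (e 1) (e 2))
    (h : ∀ k, ∃ l s, R k l s) :
    ∃ L ∈ 𝓜.S, IsFun L (fun _ => True) (fun _ => True) ∧ ∀ k l, pr k l ∈ L → ∃ s, R k l s := by
  -- `W k p l`: the pair `p = (l, s)` is a solution for `k`; `Q k p l`: it is the least one.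
  let W : M → M → M → Prop := fun k p l => ∃ s, s < p + 1 ∧ p = pr l s ∧ R k l s
  let V : M → M → Prop := fun k p => ∃ l, l < p + 1 ∧ W k p l
  let Q : M → M → M → Prop := fun k p l => W k p l ∧ ∀ p', p' < p → ¬ V k p'
  have hR3 : ∀ {t u w : (ℕ → M) → M}, 𝓜.IsTerm t → 𝓜.IsTerm u → 𝓜.IsTerm w →
      𝓜.Bounded fun e _ => R (t e) (u e) (w e) := hR.comp₃
  have hW : 𝓜.Bounded fun e _ => W (e 0) (e 1) (e 2) :=
    .bex (.add (.var 1) (.const 1)) (.and (.eq (.var 2) (.pr (.var 3) (.var 0)))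
      (hR3 (.var 1) (.var 3) (.var 0)))
  have hV : 𝓜.Bounded fun e _ => V (e 0) (e 1) :=
    .bex (.add (.var 1) (.const 1)) (hW.comp₃ (.var 1) (.var 2) (.var 0))
  have hQ : 𝓜.Bounded fun e _ => Q (e 0) (e 1) (e 2) :=
    hW.and (.ball (.var 1) (hV.comp₂ (.var 1) (.var 0)).not)
  have hex : ∀ k, ∃ p l, Q k p l := by
    intro k
    obtain ⟨l, s, hls⟩ := h k
    obtain ⟨p, ⟨l, -, hl⟩, hmin⟩ := 𝓜.exists_least (R := fun p => V k p) (x := pr l s)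
      (hV.comp₂ (.const k) (.var 0))
      ⟨l, lt_succ.2 (left_le_pr _ _), s, lt_succ.2 (right_le_pr _ _), rfl, hls⟩
    exact ⟨p, l, hl, hmin⟩
  have huniq : ∀ {k p l p' l'}, Q k p l → Q k p' l' → l = l' := by
    rintro k p l p' l' ⟨hl, hp⟩ ⟨hl', hp'⟩
    have toV : ∀ {p l}, W k p l → V k p := fun {p l} hw =>
      ⟨l, by
        obtain ⟨s, -, rfl, -⟩ := hw
        exact lt_succ.2 (left_le_pr _ _), hw⟩
    obtain rfl : p = p' := by
      rcases lt_trichotomy p p' with hlt | heq | hlt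
      · exact (hp' p hlt (toV hl)).elim
      · exact heq
      · exact (hp p' hlt (toV hl')).elim
    obtain ⟨s, -, h1, -⟩ := hl
    obtain ⟨s', -, h2, -⟩ := hl'
    exact (pr_inj.1 (h1.symm.trans h2)).1
  have hL := 𝓜.delta_comprehension
    (R := fun x p => ∃ k, k < x + 1 ∧ ∃ l, l < x + 1 ∧ x = pr k l ∧ Q k p l)
    (Q := fun x p => (∃ k, k < x + 1 ∧ ∃ l, l < x + 1 ∧ x = pr k l) ∧
      ∀ k, k < x + 1 → ∀ l, l < x + 1 → x = pr k l → ∀ l', l' < p + 1 → Q k p l' → l' = l)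
    (.bex (.add (.var 0) (.const 1)) (.bex (.add (.var 1) (.const 1))
      (.and (.eq (.var 2) (.pr (.var 1) (.var 0))) (hQ.comp₃ (.var 1) (.var 3) (.var 0)))))
    (.and .auto (.ball (.add (.var 0) (.const 1)) (.ball (.add (.var 1) (.const 1))
      (.imp .auto (.ball (.add (.var 3) (.const 1))
        (.imp (hQ.comp₃ (.var 2) (.var 4) (.var 0)) .auto)))))) ?_
  · refine ⟨_, hL, ⟨?_, fun k _ => ?_, ?_⟩, ?_⟩
    · rintro z ⟨p, k, -, l, -, rfl, -⟩
      exact ⟨k, l, rfl, trivial, trivial⟩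
    · obtain ⟨p, l, hl⟩ := hex k
      exact ⟨l, p, k, lt_succ.2 (left_le_pr _ _), l, lt_succ.2 (right_le_pr _ _), rfl, hl⟩
    · rintro k l l' ⟨p, k1, -, l1, -, h1, hQ1⟩ ⟨p', k2, -, l2, -, h2, hQ2⟩
      obtain ⟨rfl, rfl⟩ := pr_inj.1 h1
      obtain ⟨rfl, rfl⟩ := pr_inj.1 h2
      exact huniq hQ1 hQ2
    · rintro k l ⟨p, k1, -, l1, -, h1, hQ1⟩
      obtain ⟨rfl, rfl⟩ := pr_inj.1 h1
      obtain ⟨⟨s, -, -, hs⟩, -⟩ := hQ1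
      exact ⟨s, hs⟩
  · intro x
    constructor
    · rintro ⟨p, k, hk, l, hl, rfl, hQ1⟩ p'
      refine ⟨⟨k, hk, l, hl, rfl⟩, fun k' _ l' _ h l1 _ hQ2 => ?_⟩
      obtain ⟨rfl, rfl⟩ := pr_inj.1 h
      exact huniq hQ2 hQ1
    · intro h
      obtain ⟨k, hk, l, hl, rfl⟩ := (h 0).1
      obtain ⟨p, l', hQ1⟩ := hex k
      have hl' : l' < p + 1 := by
        obtain ⟨⟨s, -, rfl, -⟩, -⟩ := hQ1
        exact lt_succ.2 (left_le_pr _ _)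
      obtain rfl := (h p).2 k hk l hl rfl l' hl' hQ1
      exact ⟨p, k, hk, l', hl, rfl, hQ1⟩

/-! ### Existence of increasing lists -/

theorem exists_nil (𝓜 : Model M) : ∃ l : M, IsSeq l ∧ LhIs l 0 ∧ ∀ i b, ¬ ValIs l i b := by
  obtain ⟨l, hl, hlh, hv⟩ := exists_seq (𝓜.set_mem 0) (y := 0)
    (fun i hi => (not_lt_zero hi).elim) (fun i _ _ hi => (not_lt_zero hi).elim)
  exact ⟨l, hl, hlh, fun i b h => not_lt_zero ((hv i b).1 h).1⟩

theorem exists_append (𝓜 : Model M) {l y : M} (hl : IsSeq l) (hy : LhIs l y) (a : M) :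
    ∃ l', IsSeq l' ∧ LhIs l' (y + 1) ∧ ∀ i b, ValIs l' i b ↔ ValIs l i b ∨ (i = y ∧ b = a) := by
  have hX : {x | ∃ i, i ≤ x ∧ ∃ b, b ≤ x ∧ x = pr i b ∧ (ValIs l i b ∨ (i = y ∧ b = a))} ∈ 𝓜.S :=
    𝓜.comprehension .auto
  have hmem : ∀ i b, pr i b ∈ {x | ∃ i, i ≤ x ∧ ∃ b, b ≤ x ∧ x = pr i b ∧
      (ValIs l i b ∨ (i = y ∧ b = a))} ↔ ValIs l i b ∨ (i = y ∧ b = a) := by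
    intro i b
    constructor
    · rintro ⟨i', -, b', -, h, h'⟩
      obtain ⟨rfl, rfl⟩ := pr_inj.1 h
      exact h'
    · exact fun h => ⟨i, left_le_pr _ _, b, right_le_pr _ _, rfl, h⟩
  have hlt : ∀ {i b}, ValIs l i b → i < y := fun {i b} h => (lhIs_iff.1 hy i).2 ⟨b, h⟩
  obtain ⟨l', hl', hlh, hv⟩ := exists_seq hX (y := y + 1) (fun i hi => by
    simp only [hmem]
    rcases (lt_succ.1 hi).eq_or_lt with rfl | h
    · exact ⟨a, .inr ⟨rfl, rfl⟩⟩
    · obtain ⟨b, hb⟩ := (lhIs_iff.1 hy i).1 h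
      exact ⟨b, .inl hb⟩) (fun i b c _ hb hc => by
    rw [hmem] at hb hc
    rcases hb with hb | ⟨rfl, rfl⟩ <;> rcases hc with hc | ⟨hc, rfl⟩
    · exact hl.val_unique hb hc
    · exact absurd (hlt hb) hc.not_lt
    · exact absurd (hlt hc) (lt_irrefl i)
    · rfl)
  refine ⟨l', hl', hlh, fun i b => ?_⟩
  rw [hv, hmem]
  refine and_iff_right_of_imp ?_
  rintro (h | ⟨rfl, -⟩)
  · exact (hlt h).trans (lt_self_succ y)
  · exact lt_self_succ i

/-- An increasing list is prolonged by the next number with property `P`. -/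
theorem lists_append (𝓜 : Model M) {l y k a : M} {P : M → Prop} (hl : Lists l P k)
    (hy : LhIs l y) (hka : k ≤ a) (ha : P a) (hgap : ∀ x, k ≤ x → x < a → ¬ P x) :
    ∃ l', Lists l' P (a + 1) ∧ LhIs l' (y + 1) := by
  obtain ⟨l', hl', hlh, hv⟩ := exists_append 𝓜 hl.1.1 hy a
  have hlt : ∀ {i b}, ValIs l i b → i < y := fun {i b} h => (lhIs_iff.1 hy i).2 ⟨b, h⟩
  have hval : ∀ {i b}, ValIs l i b → b < k ∧ P b := fun {i b} h =>
    hl.2.1 i (lt_of_valIs h).1 b (lt_of_valIs h).2 h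
  refine ⟨l', ⟨⟨hl', fun i _ j _ b _ c _ hij hb hc => ?_⟩, fun i _ x _ hx => ?_,
    fun x hx hP => ?_⟩, hlh⟩
  · rw [hv] at hb hc
    rcases hb with hb | ⟨rfl, rfl⟩ <;> rcases hc with hc | ⟨rfl, rfl⟩
    · exact hl.1.lt hij hb hc
    · exact (hval hb).1.trans_le hka
    · exact absurd (hlt hc) hij.not_gt
    · exact absurd hij (lt_irrefl _)
  · rw [hv] at hx
    rcases hx with hx | ⟨-, rfl⟩
    · exact ⟨(hval hx).1.trans (lt_succ.2 hka), (hval hx).2⟩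
    · exact ⟨lt_self_succ x, ha⟩
  · have hcases : ∃ i, ValIs l' i x := by
      rcases lt_or_ge x k with h | h
      · obtain ⟨i, -, hi⟩ := hl.2.2 x h hP
        exact ⟨i, (hv i x).2 (.inl hi)⟩
      · rcases (lt_succ.1 hx).eq_or_lt with rfl | h'
        · exact ⟨y, (hv y x).2 (.inr ⟨rfl, rfl⟩)⟩
        · exact (hgap x h h' hP).elim
    obtain ⟨i, hi⟩ := hcases
    exact ⟨i, (lt_of_valIs hi).1, hi⟩

theorem exists_lists_zero (𝓜 : Model M) (P : M → Prop) : ∃ l : M, Lists l P 0 ∧ LhIs l 0 := by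
  obtain ⟨l, hl, hlh, hv⟩ := exists_nil 𝓜
  exact ⟨l, ⟨⟨hl, fun i _ _ _ b _ _ _ _ h => (hv i b h).elim⟩, fun i _ x _ h => (hv i x h).elim,
    fun x hx => (not_lt_zero hx).elim⟩, hlh⟩

theorem exists_lists {P : M → Prop} (hP : 𝓜.Bounded fun e _ => P (e 0)) (k : M) :
    ∃ l, Lists l P k := by
  have hP1 : ∀ {t : (ℕ → M) → M}, 𝓜.IsTerm t → 𝓜.Bounded fun e _ => P (t e) := hP.comp₁
  refine 𝓜.induction_exists (R := fun k l => Lists l P k) ?_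
    ((exists_lists_zero 𝓜 P).imp fun _ h => h.1) ?_ k
  · simp only [Lists, IsIncreasing]
    exact .auto
  · rintro k ⟨l, hl⟩
    obtain ⟨y, hy⟩ := hl.1.1.exists_lh
    by_cases hk : P k
    · obtain ⟨l', hl', -⟩ := lists_append 𝓜 hl hy le_rfl hk fun x h h' => absurd h' h.not_gt
      exact ⟨l', hl'⟩
    · refine ⟨l, hl.1, fun i hi x hx h => ?_, fun x hx hPx => ?_⟩
      · obtain ⟨h1, h2⟩ := hl.2.1 i hi x hx h
        exact ⟨h1.trans (lt_self_succ k), h2⟩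
      · refine hl.2.2 x ((lt_succ.1 hx).lt_of_ne ?_) hPx
        rintro rfl
        exact hk hPx

/-- An infinite set has arbitrarily long lists of its first elements. -/
theorem exists_long_lists {A : Set M} (hA : A ∈ 𝓜.S) (hinf : ¬ IsFinite A) (w : M) :
    ∃ k l, Lists l (· ∈ A) k ∧ LhIs l w := by
  have key := 𝓜.induction_exists (R := fun w p => ∃ k, k ≤ p ∧ ∃ l, l ≤ p ∧
    Lists l (· ∈ A) k ∧ LhIs l w) (by simp only [Lists, IsIncreasing]; exact .auto) ?_ ?_ w
  · obtain ⟨p, k, -, l, -, h⟩ := key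
    exact ⟨k, l, h⟩
  · obtain ⟨l, hl, hlh⟩ := exists_lists_zero 𝓜 (· ∈ A)
    exact ⟨l, 0, zero_le, l, le_rfl, hl, hlh⟩
  · rintro w ⟨-, k, -, l, -, hl, hlh⟩
    have hex : ∃ x, k ≤ x ∧ x ∈ A := by
      by_contra! h
      exact hinf ⟨k, fun x hx => not_le.1 fun h' => h x h' hx⟩
    obtain ⟨x, hx⟩ := hex
    obtain ⟨a, ⟨hka, haA⟩, hmin⟩ := 𝓜.exists_least (R := fun x => k ≤ x ∧ x ∈ A) .auto hx
    obtain ⟨l', hl', hlh'⟩ := lists_append 𝓜 hl hlh hka haA fun x h h' hxA => hmin x h' ⟨h, hxA⟩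
    exact ⟨(a + 1) + l', a + 1, le_self_add, l', le_add_self, hl', hlh'⟩

/-- An increasing list of a smaller set is not longer: entry `q` of the first list occurs in the
second one at an index `≥ q`. -/
theorem length_le_of_subset (𝓜 : Model M) {l l' y y' : M} (hl : IsIncreasing l)
    (hl' : IsIncreasing l') (hy : LhIs l y) (hy' : LhIs l' y') (h : ∀ x, InA x l → InA x l') :
    y ≤ y' := by
  simp only [hl.1.inA_iff, hl'.1.inA_iff] at h
  have key := 𝓜.induction (R := fun q => q < y → ∃ b, b < l ∧ ∃ p, p < l' ∧ ValIs l q b ∧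
    ValIs l' p b ∧ q ≤ p) .auto ?_ ?_ y'
  · by_contra! hlt
    obtain ⟨b, -, p, -, -, hp, hle⟩ := key hlt
    exact absurd ((lhIs_iff.1 hy' p).2 ⟨b, hp⟩) hle.not_gt
  · intro h0
    obtain ⟨b, hb⟩ := (lhIs_iff.1 hy 0).1 h0
    obtain ⟨p, hp⟩ := h b ⟨0, hb⟩
    exact ⟨b, (lt_of_valIs hb).2, p, (lt_of_valIs hp).1, hb, hp, zero_le⟩
  · intro q ih hq
    obtain ⟨b, -, p, -, hb, hp, hle⟩ := ih ((lt_self_succ q).trans hq)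
    obtain ⟨c, hc⟩ := (lhIs_iff.1 hy (q + 1)).1 hq
    obtain ⟨r, hr⟩ := h c ⟨q + 1, hc⟩
    exact ⟨c, (lt_of_valIs hc).2, r, (lt_of_valIs hr).1, hc, hr,
      succ_le.2 (hle.trans_lt (hl'.index_lt (hl.lt (lt_self_succ q) hb hc) hp hr))⟩

theorem cardIs_of_increasing (𝓜 : Model M) {l y : M} (hl : IsIncreasing l) (hy : LhIs l y) :
    CardIs 𝓜.S l y := by
  have hX : {x | ∃ i, i ≤ x ∧ ∃ b, b ≤ x ∧ x = pr i b ∧ ValIs l i b} ∈ 𝓜.S :=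
    𝓜.comprehension .auto
  have hmem : ∀ i b, pr i b ∈ {x | ∃ i, i ≤ x ∧ ∃ b, b ≤ x ∧ x = pr i b ∧ ValIs l i b} ↔
      ValIs l i b := by
    intro i b
    constructor
    · rintro ⟨i', -, b', -, h, h'⟩
      obtain ⟨rfl, rfl⟩ := pr_inj.1 h
      exact h'
    · exact fun h => ⟨i, left_le_pr _ _, b, right_le_pr _ _, rfl, h⟩
  refine ⟨_, hX, ⟨?_, fun i hi => ?_, fun i b c hb hc => ?_⟩, fun i j b hb hc => ?_, fun x hx => ?_⟩
  · rintro z ⟨i, -, b, -, rfl, h⟩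
    exact ⟨i, b, rfl, (lhIs_iff.1 hy i).2 ⟨b, h⟩, hl.1.inA_iff.2 ⟨i, h⟩⟩
  · simp only [hmem]
    exact (lhIs_iff.1 hy i).1 hi
  · rw [hmem] at hb hc
    exact hl.1.val_unique hb hc
  · rw [hmem] at hb hc
    exact hl.injective hb hc
  · simp only [hmem]
    exact hl.1.inA_iff.1 hx

/-! ### The finitary pigeonhole principles in a model -/

theorem agree_mono {n y : M} {f g : Set M} (hf : IsColoring n f) (h : Agree f g y) {i b : M}
    (hi : i < y) (hb : pr i b ∈ f) : pr i b ∈ g := by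
  obtain ⟨s, ⟨-, hlh, hsf⟩, -, -, hsg⟩ := h
  obtain ⟨c, hc⟩ := (lhIs_iff.1 hlh i).1 hi
  rw [hf.2.2 i b c hb (hsf i hi c hc)]
  exact hsg i hi c hc

theorem agree_iff {n y : M} {f g : Set M} (hf : IsColoring n f) (hg : IsColoring n g)
    (h : Agree f g y) {i b : M} (hi : i < y) : pr i b ∈ f ↔ pr i b ∈ g :=
  ⟨agree_mono hf h hi, agree_mono hg (h.imp fun _ h => ⟨h.2, h.1⟩) hi⟩

/-- A coloring of `[k]` extends to a coloring of all numbers. -/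
theorem exists_extension {n k : M} {f : Set M} (hf : f ∈ 𝓜.S)
    (hfun : IsFun f (fun x => x ≤ k) fun y => y ≤ n) :
    ∃ g ∈ 𝓜.S, IsColoring n g ∧ ∀ i b, i ≤ k → (pr i b ∈ g ↔ pr i b ∈ f) := by
  have hg : {x | x ∈ f ∨ ∃ i, i ≤ x ∧ k < i ∧ x = pr i 0} ∈ 𝓜.S := 𝓜.comprehension .auto
  have hdom : ∀ {i b}, pr i b ∈ f → i ≤ k := by
    intro i b h
    obtain ⟨x, y, hxy, hx, -⟩ := hfun.1 _ h
    obtain ⟨rfl, rfl⟩ := pr_inj.1 hxy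
    exact hx
  have hmem : ∀ i b, pr i b ∈ {x | x ∈ f ∨ ∃ i, i ≤ x ∧ k < i ∧ x = pr i 0} ↔
      pr i b ∈ f ∨ (k < i ∧ b = 0) := by
    intro i b
    refine or_congr_right ⟨?_, fun h => ⟨i, left_le_pr _ _, h.1, by rw [h.2]⟩⟩
    rintro ⟨i', -, hk, h⟩
    obtain ⟨rfl, rfl⟩ := pr_inj.1 h
    exact ⟨hk, rfl⟩
  refine ⟨_, hg, ⟨?_, fun i _ => ?_, fun i b c hb hc => ?_⟩, fun i b hi => ?_⟩
  · rintro z (hz | ⟨i, -, -, rfl⟩)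
    · obtain ⟨x, y, rfl, -, hy⟩ := hfun.1 z hz
      exact ⟨x, y, rfl, trivial, hy⟩
    · exact ⟨i, 0, rfl, trivial, zero_le⟩
  · simp only [hmem]
    rcases le_or_gt i k with hi | hi
    · exact (hfun.2.1 i hi).imp fun _ h => .inl h
    · exact ⟨0, .inr ⟨hi, rfl⟩⟩
  · rw [hmem] at hb hc
    rcases hb with hb | ⟨hb, rfl⟩ <;> rcases hc with hc | ⟨hc, rfl⟩
    · exact hfun.2.2 i b c hb hc
    · exact absurd (hdom hb) hc.not_ge
    · exact absurd (hdom hc) hb.not_ge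
    · rfl
  · rw [hmem]
    exact or_iff_left fun h => hi.not_gt h.1

/-- The lists of the elements below `m` of a set `A`, for all `m`, form a sequence of the model. -/
theorem exists_listing {A : Set M} (hA : A ∈ 𝓜.S) :
    ∃ L ∈ 𝓜.S, IsFun L (fun _ => True) (fun _ => True) ∧
      ∀ m l, pr m l ∈ L → Lists l (· ∈ A) m := by
  obtain ⟨L, hL, hfun, h⟩ := 𝓜.choice (R := fun m l _ => Lists l (· ∈ A) m)
    (by simp only [Lists, IsIncreasing]; exact .auto) fun m =>
      (exists_lists (𝓜 := 𝓜) (P := (· ∈ A)) .auto m).imp fun _ h => ⟨0, h⟩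
  exact ⟨L, hL, hfun, fun m l hl => (h m l hl).elim fun _ h => h⟩

/-- `l` is an increasing sequence of color `c` under `f`, longer than `F(l)`. -/
def IsLargeOfColor (F : Set M) (l c : M) (f : Set M) : Prop :=
  IsIncreasing l ∧ (∃ y, y ≤ l ∧ LhIs l y ∧ ∃ w, w < y ∧ pr l w ∈ F) ∧
    ∀ i, i < l → ∀ b, b < l → ValIs l i b → pr b c ∈ f

/-- The infinite pigeonhole principle and asymptotic stability yield the first finitary principle
for colorings of all numbers, without a bound. -/
theorem exists_largeOfColor (hIPP : HasIPP 𝓜.S) {F : Set M} (hAS : IsAS 𝓜.S F) {n : M}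
    {f : Set M} (hf : f ∈ 𝓜.S) (hfn : IsColoring n f) : ∃ l c, IsLargeOfColor F l c f := by
  obtain ⟨c, -, A, hA, hAf, hinf⟩ := hIPP n f hf hfn
  obtain ⟨L, hL, hLfun, hLA⟩ := exists_listing hA
  have hin : ∀ m x, InAof x L m ↔ x < m ∧ x ∈ A := by
    intro m x
    constructor
    · rintro ⟨l, hl, hx⟩
      exact (hLA m l hl).inA_iff.1 hx
    · intro hx
      obtain ⟨l, hl⟩ := hLfun.2.1 m trivial
      exact ⟨l, hl, (hLA m l hl).inA_iff.2 hx⟩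
  obtain ⟨i, hi⟩ := hAS.2 L hL ⟨⟨hLfun, fun m l hl => (hLA m l hl).1.1⟩,
    fun m x h => by
      rw [hin] at h ⊢
      exact ⟨h.1.trans (lt_self_succ m), h.2⟩,
    A, hA, fun x => by
      simp only [hin]
      exact ⟨fun h => ⟨x + 1, lt_self_succ x, h⟩, fun ⟨_, h⟩ => h.2⟩⟩
  obtain ⟨k, hk⟩ := hLfun.2.1 i trivial
  obtain ⟨w, hw⟩ := hAS.1.1.2.1 k trivial
  -- From index `i` on, `F` has the value `w` on the lists, so a list with more than `w` entries
  -- is as required.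
  obtain ⟨m, l₀, hl₀, hlh₀⟩ := exists_long_lists hA hinf (w + 1)
  obtain ⟨k', l, hk', hl, w', hkw', hlw'⟩ := hi (i + m) le_self_add
  obtain rfl := hLfun.2.2 i k k' hk hk'
  obtain rfl := hAS.1.1.2.2 k w w' hw hkw'
  have hlA := hLA _ l hl
  obtain ⟨y, hy⟩ := hlA.1.1.exists_lh
  have hwy : w + 1 ≤ y := 𝓜.length_le_of_subset hl₀.1 hlA.1 hlh₀ hy fun x hx => by
    rw [hl₀.inA_iff] at hx
    exact hlA.inA_iff.2 ⟨hx.1.trans_le le_add_self, hx.2⟩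
  exact ⟨l, c, hlA.1, ⟨y, lh_le hy, hy, w, succ_le.1 hwy, hlw'⟩, fun j hj b hb h =>
    (hAf b).1 (hlA.2.1 j hj b hb h).2⟩

theorem hasFIPP2 (hC : ∀ B ∈ CUB Sigma00, ∀ e s, (∀ i, s i ∈ 𝓜.S) → Sat 𝓜.S B e s)
    (hIPP : HasIPP 𝓜.S) : HasFIPP2 𝓜.S := by
  intro n F hF hAS
  have hcub := sigma00_cub hC (R := IsLargeOfColor F)
    (by simp only [IsLargeOfColor, IsIncreasing]; exact .auto) n
    (fun f _ hfn z => ⟨z, fun g _ hgn hag l c hl _ => ?_⟩)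
    fun f hf hfn => exists_largeOfColor hIPP hAS hf hfn
  · obtain ⟨z, hz⟩ := hcub
    refine ⟨z, fun f hf hfun => ?_⟩
    obtain ⟨g, hg, hgn, hgf⟩ := exists_extension hf hfun
    obtain ⟨l, c, hlz, -, hl, ⟨y, -, hy, w, hwy, hlw⟩, hcol⟩ := hz g hg hgn
    have hA : ∀ x, InA x l → x ≤ z ∧ pr x c ∈ f := by
      intro x hx
      obtain ⟨i, hi⟩ := hl.1.inA_iff.1 hx
      obtain ⟨hil, hxl⟩ := lt_of_valIs hi
      have hxz := hxl.le.trans hlz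
      exact ⟨hxz, (hgf x c hxz).1 (hcol i hil x hxl hi)⟩
    exact ⟨l, hl.1, fun x hx => (hA x hx).1, ⟨w, hlw, y, 𝓜.cardIs_of_increasing hl hy, hwy⟩,
      fun x x' hx hx' => ⟨c, (hA x hx).2, (hA x' hx').2⟩⟩
  · refine and_congr_right fun _ => and_congr_right fun _ => ?_
    exact forall₄_congr fun i _ b hb => imp_congr_right fun _ =>
      agree_iff hfn hgn hag (hb.trans_le hl)

/-- The list `l` of the numbers of color `c` under the finite coloring `s` has at most `F(l)`
entries. -/
def IsSmallClass (F : Set M) (s c l : M) : Prop :=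
  Lists l (fun x => ValIs s x c) s ∧ ∃ y, y ≤ l ∧ LhIs l y ∧ ∀ w, w < y → pr l w ∉ F

/-- The finite sequence `s` prolongs the initial segment of length `k` of `f`. -/
def Prolongs (s k : M) (f : Set M) : Prop :=
  IsSeq s ∧ (∃ y, y ≤ s ∧ LhIs s y ∧ k ≤ y) ∧
    ∀ x, x < k → ∀ b, b < s → ValIs s x b → pr x b ∈ f

/-- Some finite coloring below `t` that prolongs the initial segment of length `k` of `f` has only
small color classes, with lists below `t`. -/
def HasSmallClasses (F : Set M) (n t k : M) (f : Set M) : Prop :=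
  ∃ s, s ≤ t ∧ Prolongs s k f ∧ ∀ c, c ≤ n → ∃ l, l ≤ t ∧ IsSmallClass F s c l

/-- The infinite pigeonhole principle and stability near infinite sets: from some `k` on, every
finite coloring that prolongs the initial segment of `f` has a large color class. -/
theorem exists_no_smallClasses (hIPP : HasIPP 𝓜.S) {F : Set M} (hF : F ∈ 𝓜.S)
    (hAS : IsASNIS 𝓜.S F) {n : M} {f : Set M} (hf : f ∈ 𝓜.S) (hfn : IsColoring n f) :
    ∃ k, ∀ t, ¬ HasSmallClasses F n t k f := by
  by_contra! hsmall
  obtain ⟨c, hc, A, hA, hAf, hinf⟩ := hIPP n f hf hfn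
  obtain ⟨L, hL, hLfun, hLR⟩ := 𝓜.choice (R := fun k l s => Prolongs s k f ∧ IsSmallClass F s c l)
    (by simp only [Prolongs, IsSmallClass, Lists, IsIncreasing]; exact .auto) fun k => by
      obtain ⟨t, s, -, hs, h⟩ := hsmall k
      obtain ⟨l, -, hl⟩ := h c hc
      exact ⟨l, s, hs, hl⟩
  have hin : ∀ {k l x}, pr k l ∈ L → x < k → (InA x l ↔ x ∈ A) := by
    intro k l x hl hx
    obtain ⟨s, ⟨hs, ⟨y, -, hy, hky⟩, hsf⟩, hls, -⟩ := hLR k l hl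
    rw [hls.inA_iff, hAf]
    constructor
    · exact fun h => hsf x hx c (lt_of_valIs h.2).2 h.2
    · intro h
      obtain ⟨b, hb⟩ := (lhIs_iff.1 hy x).1 (hx.trans_le hky)
      obtain rfl := hfn.2.2 x b c (hsf x hx b (lt_of_valIs hb).2 hb) h
      exact ⟨(lt_of_valIs hb).1, hb⟩
  have hinc : ∀ {k l}, pr k l ∈ L → IsIncreasing l := fun {k l} hl => by
    obtain ⟨s, -, hls, -⟩ := hLR k l hl
    exact hls.1
  obtain ⟨i, hi⟩ := hAS.2 L hL ⟨A, hA, hinf, ⟨hLfun, fun m l hl => (hinc hl).1⟩, by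
    rintro B - ⟨b, hb⟩
    refine ⟨b, fun j hj x => and_congr_left fun hx => ?_⟩
    have hxj := (hb x hx).trans_le hj
    constructor
    · rintro ⟨l, hl, h⟩
      exact (hin hl hxj).1 h
    · intro h
      obtain ⟨l, hl⟩ := hLfun.2.1 j trivial
      exact ⟨l, hl, (hin hl hxj).2 h⟩⟩
  obtain ⟨p, hp⟩ := hLfun.2.1 i trivial
  obtain ⟨w, hw⟩ := hAS.1.1.2.1 p trivial
  -- From index `i` on, `F` has the value `w`, so the lists have at most `w` entries; but they
  -- contain longer and longer initial parts of the infinite set `A`.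
  obtain ⟨m, l₀, hl₀, hlh₀⟩ := exists_long_lists hA hinf (w + 1)
  obtain ⟨p', l, hp', hl, w', hpw', hlw'⟩ := hi (i + m) le_self_add
  obtain rfl := hLfun.2.2 i p p' hp hp'
  obtain rfl := hAS.1.1.2.2 p w w' hw hpw'
  obtain ⟨-, -, -, y, -, hy, hyF⟩ := hLR _ l hl
  have hwy : w + 1 ≤ y := 𝓜.length_le_of_subset hl₀.1 (hinc hl) hlh₀ hy fun x hx => by
    rw [hl₀.inA_iff] at hx
    exact (hin hl (hx.1.trans_le le_add_self)).2 hx.2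
  exact hyF w (succ_le.1 hwy) hlw'

theorem hasFIPP3 (hC : ∀ B ∈ CUB Pi01, ∀ e s, (∀ i, s i ∈ 𝓜.S) → Sat 𝓜.S B e s)
    (hIPP : HasIPP 𝓜.S) : HasFIPP3 𝓜.S := by
  intro n F hF hAS
  have hcub := pi01_cub hC (R := fun t k f => ¬ HasSmallClasses F n t k f)
    (by
      simp only [HasSmallClasses, Prolongs, IsSmallClass, Lists, IsIncreasing]
      exact .auto) n
    (fun f _ hfn z => ⟨z, fun g _ hgn hag k hk => ?_⟩)
    fun f hf hfn => exists_no_smallClasses hIPP hF hAS hf hfn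
  · obtain ⟨z, hz⟩ := hcub
    refine ⟨z, fun f hf hfun => ?_⟩
    obtain ⟨g, hg, hgn, hgf⟩ := exists_extension hf hfun
    obtain ⟨k, hkz, hk⟩ := hz g hg hgn
    have hdom : ∀ {i b}, pr i b ∈ f → i ≤ z := by
      intro i b h
      obtain ⟨x, y, hxy, hx, -⟩ := hfun.1 _ h
      obtain ⟨rfl, rfl⟩ := pr_inj.1 hxy
      exact hx
    obtain ⟨s, hs, hlh, hsv⟩ := exists_seq hf (y := z + 1)
      (fun i hi => hfun.2.1 i (lt_succ.1 hi)) fun i b c _ => hfun.2.2 i b c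
    by_contra! hno
    have hsmall : ∀ c, c < n + 1 → ∃ l, IsSmallClass F s c l := by
      intro c hc
      obtain ⟨l, hl⟩ := exists_lists (𝓜 := 𝓜) (P := fun x => ValIs s x c) .auto s
      obtain ⟨y, hy⟩ := hl.1.1.exists_lh
      refine ⟨l, hl, y, lh_le hy, hy, fun w hw hlw => ?_⟩
      refine hno l hl.1.1 c (lt_succ.1 hc) (fun x => ?_)
        ⟨w, hlw, y, 𝓜.cardIs_of_increasing hl.1 hy, hw⟩
      rw [hl.inA_iff]
      constructor
      · exact fun h => ((hsv x c).1 h.2).2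
      · intro h
        have hx := (hsv x c).2 ⟨lt_succ.2 (hdom h), h⟩
        exact ⟨(lt_of_valIs hx).1, hx⟩
    obtain ⟨t, ht⟩ := 𝓜.collection (R := fun c l => IsSmallClass F s c l)
      (by simp only [IsSmallClass, Lists, IsIncreasing]; exact .auto) (n + 1) hsmall
    refine hk (s + t) ⟨s, le_self_add, ⟨hs, ⟨z + 1, lh_le hlh, hlh, hkz.trans (lt_self_succ z).le⟩,
      fun x _ b _ h => ?_⟩, fun c hc => ?_⟩
    · have hxb := ((hsv x b).1 h).2
      exact (hgf x b (hdom hxb)).2 hxb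
    · obtain ⟨l, hl, h⟩ := ht c (lt_succ.2 hc)
      exact ⟨l, hl.le.trans le_add_self, h⟩
  · have key : ∀ s, Prolongs s k f ↔ Prolongs s k g := fun s =>
      and_congr_right fun _ => and_congr_right fun _ => forall₂_congr fun x hx =>
        forall₃_congr fun b _ _ => agree_iff hfn hgn hag (hx.trans_le hk)
    simp only [HasSmallClasses, key]

end Model

/-! ### Passage to provability -/

/-- To derive an implication between sentences, it suffices to prove it in all listed models of
`RCA₀` and the additional axioms `T`. -/
theorem proves_imp_of_models {T : Set Fml} {A B : Fml}
    (h : ∀ (M : Type) [Numbers M] (𝓜 : Model M),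
      (∀ C ∈ T, ∀ e s, (∀ i, s i ∈ 𝓜.S) → Sat 𝓜.S C e s) →
      ∀ e s, Sat 𝓜.S A e s → Sat 𝓜.S B e s) : Proves (RCA0 ∪ T) (Fml.imp A B) := by
  refine proves_of_sat fun M _ _ _ _ _ _ S hS hne hT e s hs hA => ?_
  obtain ⟨num, hnum⟩ := exists_surjective_nat M
  obtain ⟨set, hset⟩ := hS.exists_eq_range hne
  let 𝓜 : Model M :=
    { S, num, num_surj := hnum, set
      set_mem := fun i => hset ▸ ⟨i, rfl⟩
      set_surj := fun X hX => by
        rw [hset] at hX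
        exact hX
      rca := fun A hA => hT A (.inl hA) }
  exact @h M 𝓜.numbers 𝓜 (fun C hC => hT C (.inr hC)) e s hA

end SOA

theorem theorem4 :
    SOA.Proves (SOA.RCA0 ∪ SOA.CUB SOA.Sigma00) (SOA.Fml.imp SOA.IPP SOA.FIPP2) ∧
    SOA.Proves (SOA.RCA0 ∪ SOA.CUB SOA.Pi01) (SOA.Fml.imp SOA.IPP SOA.FIPP3) := by
  refine ⟨SOA.proves_imp_of_models fun M _ 𝓜 hC e s h => ?_,
    SOA.proves_imp_of_models fun M _ 𝓜 hC e s h => ?_⟩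
  · rw [SOA.sat_FIPP2]
    exact 𝓜.hasFIPP2 hC ((SOA.sat_IPP e s).1 h)
  · rw [SOA.sat_FIPP3]
    exact 𝓜.hasFIPP3 hC ((SOA.sat_IPP e s).1 h)
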